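/- Let $d\ge 1$, let $\Omega\subset\mathbb{R}^d$ be a bounded (not necessarily convex) polygonal or polyhedral domain, and let $\mathbb{M}$ be a (measurable) field of symmetric $d\times d$ matrices on $\Omega$, independent of time, with $\underline{m}I\le\mathbb{M}(x)\le\overline{m}I$ for all $x\in\Omega$, where $\underline m,\overline m>0$. Let $p\ge 1$ with $4p>d$, and let $\hat K$ be an equilateral reference simplex with $|\hat K|=1$. *Functional.* Consider simplicial meshes $\mathcal{T}_h$ of $\Omega$ with $N$ elements, vertices $x_1,\dots,x_{N_v}$ and fixed connectivity. For an element $K$ let $F_K'$ be the Jacobian matrix of the affine map $\hat K\to K$, $|K|$ the volume, $\mathbb{M}_K$ the average of $\mathbb{M}$ over $K$, and $a_{K,\mathbb{M}}$ the minimum altitude of $K$ in the metric $\mathbb{M}_K$. Put $$I_h(\mathcal{T}_h)=\sum_{K\in\mathcal{T}_h}|K|\det(\mathbb{M}_K)^{\frac12}\left\|(F_K')^{-1}\mathbb{M}_K^{-1}(F_K')^{-T}-\Big(\frac{\sigma}{N}\Big)^{-\frac2d}I\right\|_F^{2p},$$ where either $\sigma=\sigma_h(\mathcal{T}_h)=\sum_{K}|K|\det(\mathbb{M}_K)^{1/2}$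 or $\sigma$ is a fixed positive constant. A mesh is nonsingular if its elements are nondegenerate, have disjoint interiors and cover $\overline\Omega$ exactly. *Trajectory.* Let $\mathcal{T}_h(t)$, $0\le t<T\le\infty$, be a trajectory of the semi-discrete moving mesh equation $$\frac{dx_i}{dt}=-\frac{P_i}{\tau}\,\Pi_i\left(\frac{\partial I_h}{\partial x_i}\right)^T,\qquad i=1,\dots,N_v,$$ with $\tau>0$, $P_i>0$, starting from a nonsingular mesh $\mathcal{T}_h(0)$ of $\Omega$. Here $\Pi_i$ is the orthogonal projection onto a subspace $V_i$ that is parallel to all boundary facets of $\mathcal{T}_h(0)$ containing $x_i$, a boundary facet being one that belongs to a single element. Thus $\Pi_i$ is the identity for a free interior vertex, boundary vertices only slide along the boundary, and corners are fixed. The vertices are assumed to move continuously. The equation is assumed at those times $t\in[0,T)$ at which no element is degenerate; $I_h$ is then assumed to be differentiable with respect to vertex displacements in the spaces $V_i$. *Conclusion.* The mesh $\mathcal{T}_h(t)$ is nonsingular for all $t\in[0,T)$, and $\sigma_h(\mathcal{T}_h(t))\ge\underline m^{d/2}|\Omega|$. If moreover $\overline m\ge1$ (which can always be achieved by enlarging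 the upper bound $\overline m$) and $(d,N)\ne(1,1)$, then for all $t\in[0,T)$ and all $K\in\mathcal{T}_h(t)$ $$a_{K,\mathbb{M}}\ge C_1\,\overline m^{-\frac{d}{2(4p-d)}}N^{-\frac{4p}{d(4p-d)}},\qquad |K|\ge C_2\,\overline m^{-\frac{d^2}{2(4p-d)}-\frac d2}N^{-\frac{4p}{4p-d}},$$ $$C_1=\left(\frac{2^{6p}\,(d!)^{\frac{4p}{d}}\,\alpha}{d^{4p}(d+1)^{4p-\frac{2p}{d}}\big(\beta|\Omega|+I_h(\mathcal{T}_h(0))\big)}\right)^{\frac1{4p-d}},\qquad C_2=\frac{C_1^d}{d!},$$ $$\alpha=\frac{2^{1-2p}\,\underline m^{d/2}}{\overline m^{2p}d^{2p}},\qquad \beta=\underline m^{d/2}(\gamma^2d)^p,\qquad \gamma=\Big(\frac{\sigma}{N}\Big)^{-\frac2d},$$ where $\sigma$ in $\gamma$ is its value at $\mathcal{T}_h(t)$. By the lower bound on $\sigma_h$, the constants $C_1,C_2$ are bounded below by positive constants independent of $t$. -/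

import Mathlib

open MeasureTheory

namespace MovingMesh

noncomputable section

/-- Points of `ℝᵈ` with the Euclidean norm. -/
abbrev Pt (d : ℕ) : Type := EuclideanSpace ℝ (Fin d)

/-- The positions of `Nv` mesh vertices. -/
abbrev Config (d Nv : ℕ) : Type := Fin Nv → Pt d

/-- The connectivity of a simplicial mesh with `N` elements and `Nv` vertices: `conn k j` is the
global index of the `j`-th vertex of the `k`-th element. -/
abbrev Connectivity (d N Nv : ℕ) : Type := Fin N → Fin (d + 1) → Fin Nv

/-- A bounded, not necessarily convex, polygonal or polyhedral domain: a bounded, nonempty,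
connected open set whose boundary lies in a finite union of proper affine subspaces. -/
structure IsPolyhedralDomain {d : ℕ} (Ω : Set (Pt d)) : Prop where
  isOpen : IsOpen Ω
  isBounded : Bornology.IsBounded Ω
  isConnected : IsConnected Ω
  flat_boundary : ∃ H : Finset (AffineSubspace ℝ (Pt d)),
    (∀ h ∈ H, h ≠ ⊤) ∧ frontier Ω ⊆ ⋃ h ∈ H, (h : Set (Pt d))

/-- A symmetric metric tensor field with `mlo I ≤ M(y) ≤ mhi I` on `Ω` (symmetry is part of
`Matrix.PosSemidef`), with measurable entries. -/
structure IsMetricTensor {d : ℕ} (Ω : Set (Pt d)) (mlo mhi : ℝ)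
    (M : Pt d → Matrix (Fin d) (Fin d) ℝ) : Prop where
  measurable : ∀ i j, AEMeasurable (fun y => M y i j) (volume.restrict Ω)
  lower : ∀ y ∈ Ω, (M y - mlo • (1 : Matrix (Fin d) (Fin d) ℝ)).PosSemidef
  upper : ∀ y ∈ Ω, (mhi • (1 : Matrix (Fin d) (Fin d) ℝ) - M y).PosSemidef

/-! ### Simplices -/

/-- The closed simplex with vertices `v`. -/
def simplex {d : ℕ} (v : Fin (d + 1) → Pt d) : Set (Pt d) := convexHull ℝ (Set.range v)

/-- The volume `|K|` of the simplex with vertices `v`. -/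
def simplexVolume {d : ℕ} (v : Fin (d + 1) → Pt d) : ℝ := volume.real (simplex v)

/-- The edge matrix `[v₁ - v₀, …, v_d - v₀]`. -/
def edgeMatrix {d : ℕ} (v : Fin (d + 1) → Pt d) : Matrix (Fin d) (Fin d) ℝ :=
  Matrix.of fun i j => v j.succ i - v 0 i

/-- An equilateral reference simplex of volume one. -/
structure IsReferenceElement {d : ℕ} (ξ : Fin (d + 1) → Pt d) : Prop where
  equilateral : ∃ ℓ : ℝ, ∀ i j, i ≠ j → dist (ξ i) (ξ j) = ℓ
  unitary : simplexVolume ξ = 1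

/-- The Jacobian matrix `F_K'` of the affine map taking the vertices `ξ` of the reference element
to the vertices `v` of `K`. -/
def jacobian {d : ℕ} (ξ v : Fin (d + 1) → Pt d) : Matrix (Fin d) (Fin d) ℝ :=
  edgeMatrix v * (edgeMatrix ξ)⁻¹

/-- The (entrywise) average `M_K` of `M` over the simplex with vertices `v`. -/
def avgMetric {d : ℕ} (M : Pt d → Matrix (Fin d) (Fin d) ℝ) (v : Fin (d + 1) → Pt d) :
    Matrix (Fin d) (Fin d) ℝ :=
  Matrix.of fun i j => ⨍ y in simplex v, M y i j

/-- The length `√(uᵀ A u)` of `u` in the constant metric `A`. -/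
def metricLength {d : ℕ} (A : Matrix (Fin d) (Fin d) ℝ) (u : Pt d) : ℝ :=
  Real.sqrt (∑ i, ∑ j, u i * A i j * u j)

/-- The altitude from the `j`-th vertex in the metric `A`: the distance, measured in `A`, from that
vertex to the affine hull of the other vertices. -/
def altitude {d : ℕ} (A : Matrix (Fin d) (Fin d) ℝ) (v : Fin (d + 1) → Pt d) (j : Fin (d + 1)) :
    ℝ :=
  sInf ((fun z => metricLength A (v j - z)) ''
    (affineSpan ℝ (v '' {l | l ≠ j}) : Set (Pt d)))

/-- The minimum altitude in the metric `A`. -/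
def minAltitude {d : ℕ} (A : Matrix (Fin d) (Fin d) ℝ) (v : Fin (d + 1) → Pt d) : ℝ :=
  ⨅ j, altitude A v j

/-! ### Meshes -/

/-- The vertices of the `k`-th element. -/
def elem {d N Nv : ℕ} (conn : Connectivity d N Nv) (x : Config d Nv) (k : Fin N) :
    Fin (d + 1) → Pt d :=
  fun j => x (conn k j)

/-- No element is degenerate. -/
def Nondegenerate {d N Nv : ℕ} (conn : Connectivity d N Nv) (x : Config d Nv) : Prop :=
  ∀ k, AffineIndependent ℝ (elem conn x k)

/-- The elements form a nonsingular mesh of `Ω`: they are nondegenerate, do not overlap and cover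
`Ω` exactly. -/
structure IsNonsingularMesh {d N Nv : ℕ} (Ω : Set (Pt d)) (conn : Connectivity d N Nv)
    (x : Config d Nv) : Prop where
  nondegenerate : Nondegenerate conn x
  disjoint : ∀ k l, k ≠ l →
    Disjoint (interior (simplex (elem conn x k))) (interior (simplex (elem conn x l)))
  cover : ⋃ k, simplex (elem conn x k) = closure Ω

/-- The global indices of the vertices of the facet of the `k`-th element opposite to its `j`-th
vertex. -/
def facet {d N Nv : ℕ} (conn : Connectivity d N Nv) (k : Fin N) (j : Fin (d + 1)) :
    Set (Fin Nv) :=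
  conn k '' {l | l ≠ j}

/-- A boundary facet: a facet that is not shared with another element. -/
def IsBoundaryFacet {d N Nv : ℕ} (conn : Connectivity d N Nv) (k : Fin N) (j : Fin (d + 1)) :
    Prop :=
  ∀ k' j', k' ≠ k → facet conn k' j' ≠ facet conn k j

/-- The directions in which the `i`-th vertex of the mesh `x` can slide along the boundary: those
parallel to all boundary facets that contain it. This is everything for an interior vertex, the
tangent hyperplane for a vertex in a flat part of the boundary, and `{0}` for a corner. -/
def slideSpace {d N Nv : ℕ} (conn : Connectivity d N Nv) (x : Config d Nv) (i : Fin Nv) :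
    Submodule ℝ (Pt d) :=
  ⨅ (k : Fin N) (j : Fin (d + 1)) (_ : IsBoundaryFacet conn k j) (_ : i ∈ facet conn k j),
    vectorSpan ℝ (x '' facet conn k j)

/-! ### The functional -/

/-- The Frobenius norm. -/
def frobNorm {d : ℕ} (A : Matrix (Fin d) (Fin d) ℝ) : ℝ :=
  Real.sqrt (∑ i, ∑ j, A i j ^ 2)

/-- `σ_h = ∑_K |K| det(M_K)^{1/2}`. -/
def sigmaH {d N Nv : ℕ} (M : Pt d → Matrix (Fin d) (Fin d) ℝ) (conn : Connectivity d N Nv)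
    (x : Config d Nv) : ℝ :=
  ∑ k, simplexVolume (elem conn x k) * Real.sqrt (avgMetric M (elem conn x k)).det

/-- The meshing functional
`∑_K |K| det(M_K)^{1/2} ‖(F_K')⁻¹ M_K⁻¹ (F_K')⁻ᵀ - (σ/N)^{-2/d} I‖_F^{2p}`,
with the value `σ` of `σ_h` as an argument. -/
def energy {d N Nv : ℕ} (M : Pt d → Matrix (Fin d) (Fin d) ℝ) (ξ : Fin (d + 1) → Pt d) (p : ℝ)
    (conn : Connectivity d N Nv) (σ : ℝ) (x : Config d Nv) : ℝ :=
  ∑ k, simplexVolume (elem conn x k) * Real.sqrt (avgMetric M (elem conn x k)).det *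
    frobNorm ((jacobian ξ (elem conn x k))⁻¹ * (avgMetric M (elem conn x k))⁻¹ *
        ((jacobian ξ (elem conn x k))⁻¹).transpose -
      ((σ / N) ^ (-(2 : ℝ) / d)) • (1 : Matrix (Fin d) (Fin d) ℝ)) ^ (2 * p)

/-! ### The moving mesh equation -/

/-- `x`, on the time interval `[0, T)`, is a trajectory of the moving mesh equation
`dxᵢ/dt = -(Pᵢ/τ) (∂I/∂xᵢ)ᵀ`, where the velocity of the `i`-th vertex is projected orthogonally to
the space `V i` (all of `ℝᵈ` for a vertex that moves freely, a space of directions along the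
boundary for a boundary vertex, `{0}` for a fixed vertex).

The vertices move continuously, and the equation holds at every time at which the mesh has no
degenerate element, so that the functional is defined there; nondegeneracy itself is not required.
The functional need only be differentiable with respect to the admissible motions of the vertices;
`L` is its derivative, and `v` is the orthogonal projection of `-(Pᵢ/τ) (∂I/∂xᵢ)ᵀ` to `V i`. The
time derivative is one-sided at `t = 0`. -/
structure IsTrajectory {d N Nv : ℕ} (conn : Connectivity d N Nv) (I : Config d Nv → ℝ)
    (V : Fin Nv → Submodule ℝ (Pt d)) (P : Fin Nv → ℝ → ℝ) (τ : ℝ) (T : EReal)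
    (x : ℝ → Config d Nv) : Prop where
  continuousOn : ContinuousOn x {t | 0 ≤ t ∧ (t : EReal) < T}
  equation : ∀ t : ℝ, 0 ≤ t → (t : EReal) < T → Nondegenerate conn (x t) →
    ∃ L : Config d Nv →L[ℝ] ℝ,
      HasFDerivWithinAt I L {y | ∀ i, y i - x t i ∈ V i} (x t) ∧
      ∀ i, ∃ v ∈ V i, HasDerivWithinAt (fun s => x s i) v (Set.Ici 0) t ∧
        ∀ w ∈ V i, inner ℝ v w = -(P i t / τ) * L (Pi.single i w)

/-! ### The constants -/

/-- `α = 2^{1-2p} mlo^{d/2} / (mhi^{2p} d^{2p})`. -/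
def alpha (d : ℕ) (p mlo mhi : ℝ) : ℝ :=
  2 ^ (1 - 2 * p) * mlo ^ ((d : ℝ) / 2) / (mhi ^ (2 * p) * (d : ℝ) ^ (2 * p))

/-- `β = mlo^{d/2} (γ² d)^p` with `γ = (σ/N)^{-2/d}`. -/
def beta (d N : ℕ) (p mlo σ : ℝ) : ℝ :=
  mlo ^ ((d : ℝ) / 2) * (((σ / N) ^ (-(2 : ℝ) / d)) ^ 2 * d) ^ p

/-- The constant `C₁`, in terms of `α`, `β`, `|Ω|` and the initial energy. -/
def C1 (d : ℕ) (p α β volΩ I₀ : ℝ) : ℝ :=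
  (2 ^ (6 * p) * (d.factorial : ℝ) ^ (4 * p / d) * α /
    ((d : ℝ) ^ (4 * p) * ((d : ℝ) + 1) ^ (4 * p - 2 * p / d) * (β * volΩ + I₀))) ^
      (1 / (4 * p - d))

/-- The constant `C₂ = C₁ᵈ / d!`. -/
def C2 (d : ℕ) (p α β volΩ I₀ : ℝ) : ℝ :=
  C1 d p α β volΩ I₀ ^ d / (d.factorial : ℝ)

end

end MovingMesh

/-!
Let `ω` be a small vector. The projective map `y ↦ y / (1 - ⟨ω, y⟩)` has the Jacobian determinant
`(1 - ⟨ω, y⟩)^{-(d+1)}` and takes simplices to simplices and hyperplanes to hyperplanes. While no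
element degenerates, the total signed volume of the projected mesh is constant: its derivative is a
sum over facets, in which shared facets cancel and a boundary facet contributes nothing, because it
moves inside a fixed hyperplane. Hence `∑_K ∫_K (1 - ⟨ω, y⟩)^{-(d+1)} dy` is conserved for all small
`ω`. The power series in `ω` yields all moments, hence the characteristic function, hence the
measure `∑_K vol|_K` itself; it stays equal to `vol|_{closure Ω}`, so the elements neither overlap
nor leave a part of `Ω` uncovered.

The energy `I_h` does not increase along a trajectory, and on a nonsingular mesh it bounds each
`|K| ‖(F_K')⁻¹ M_K⁻¹ (F_K')⁻ᵀ‖_F^{2p}`. If `ρ` is the reciprocal of the largest metric length of a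
gradient of a barycentric coordinate of `K`, this norm is at least a constant times `ρ⁻²`, while `ρ`
is at most the minimum altitude and `ρ^d` is at most a constant times `|K|`. As `4p > d`, this
bounds `ρ` from below uniformly in time, and by continuity no element ever degenerates.
-/

namespace MovingMesh

noncomputable section

open scoped Matrix

variable {d N Nv : ℕ}

/-! ### Homogeneous coordinates -/

/-- The homogeneous coordinates `(1, y)` of a point. -/
def homPoint (y : Pt d) : Fin (d + 1) → ℝ := Fin.cons 1 y.ofLp

/-- The homogeneous coordinates `(0, u)` of a direction. -/
def homDir (u : Pt d) : Fin (d + 1) → ℝ := Fin.cons 0 u.ofLp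

/-- The matrix whose rows are the homogeneous coordinates of the vertices of a simplex. -/
def homMatrix (v : Fin (d + 1) → Pt d) : Matrix (Fin (d + 1)) (Fin (d + 1)) ℝ :=
  Matrix.of fun j => homPoint (v j)

@[simp] lemma homPoint_zero (y : Pt d) : homPoint y 0 = 1 := rfl

@[simp] lemma homPoint_succ (y : Pt d) (i : Fin d) : homPoint y i.succ = y i := rfl

@[simp] lemma homDir_zero (u : Pt d) : homDir u 0 = 0 := rfl

@[simp] lemma homDir_succ (u : Pt d) (i : Fin d) : homDir u i.succ = u i := rfl

@[simp] lemma homMatrix_apply (v : Fin (d + 1) → Pt d) (j : Fin (d + 1)) :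
    homMatrix v j = homPoint (v j) := rfl

lemma homPoint_sub_homPoint (y z : Pt d) : homPoint y - homPoint z = homDir (y - z) := by
  ext i
  cases i using Fin.cases <;> simp

lemma homPoint_lineMap (y z : Pt d) (δ : ℝ) :
    homPoint (AffineMap.lineMap y z δ) = AffineMap.lineMap (homPoint y) (homPoint z) δ := by
  ext i
  cases i using Fin.cases <;> simp [AffineMap.lineMap_apply]

lemma vecMul_homMatrix (v : Fin (d + 1) → Pt d) (w : Fin (d + 1) → ℝ) :
    Matrix.vecMul w (homMatrix v) = Fin.cons (∑ j, w j) (∑ j, w j • v j).ofLp := by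
  ext i
  cases i using Fin.cases <;> simp [Matrix.vecMul, dotProduct]

lemma vecMul_homMatrix_eq_homPoint_iff {v : Fin (d + 1) → Pt d} {w : Fin (d + 1) → ℝ}
    {y : Pt d} :
    Matrix.vecMul w (homMatrix v) = homPoint y ↔ ∑ j, w j = 1 ∧ ∑ j, w j • v j = y := by
  rw [vecMul_homMatrix, homPoint, Fin.cons_inj, WithLp.ext_iff]

lemma det_homMatrix (v : Fin (d + 1) → Pt d) : (homMatrix v).det = (edgeMatrix v).det := by
  have hrows : (homMatrix v).det = (Matrix.of (Fin.cons (homPoint (v 0))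
      (fun j : Fin d => homDir (v j.succ - v 0)) : Fin (d + 1) → Fin (d + 1) → ℝ)).det := by
    refine Matrix.det_eq_of_forall_row_eq_smul_add_const (Fin.cons 0 fun _ => 1) 0 rfl ?_
    intro i j
    cases i using Fin.cases <;> simp [← homPoint_sub_homPoint]
  rw [hrows, Matrix.det_succ_column_zero, Fin.sum_univ_succ]
  simp only [Matrix.of_apply, Fin.cons_zero, homPoint_zero, Fin.cons_succ, homDir_zero, mul_zero,
    zero_mul, Finset.sum_const_zero, add_zero, Fin.val_zero, pow_zero, one_mul]
  exact Matrix.det_transpose (edgeMatrix v)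

lemma affineIndependent_iff_det_homMatrix_ne_zero {v : Fin (d + 1) → Pt d} :
    AffineIndependent ℝ v ↔ (homMatrix v).det ≠ 0 := by
  have hker : ∀ w : Fin (d + 1) → ℝ, Matrix.vecMul w (homMatrix v) = 0 ↔
      ∑ j, w j = 0 ∧ ∑ j, w j • v j = 0 := fun w => by
    rw [vecMul_homMatrix, ← WithLp.ofLp_eq_zero 2]
    exact Matrix.cons_eq_zero_iff
  have hindep : AffineIndependent ℝ v ↔
      ∀ w : Fin (d + 1) → ℝ, Matrix.vecMul w (homMatrix v) = 0 → w = 0 := by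
    simp_rw [affineIndependent_iff_of_fintype, hker, funext_iff]
    refine forall_congr' fun w => ⟨fun h hw => h hw.1 ?_, fun h h0 hw => h ⟨h0, ?_⟩⟩
    · rw [Finset.weightedVSub_eq_linear_combination _ hw.1, hw.2]
    · rwa [Finset.weightedVSub_eq_linear_combination _ h0] at hw
  rw [hindep, Ne, ← Matrix.exists_vecMul_eq_zero_iff]
  grind

lemma isUnit_homMatrix {v : Fin (d + 1) → Pt d} (hv : AffineIndependent ℝ v) :
    IsUnit (homMatrix v).det :=
  (affineIndependent_iff_det_homMatrix_ne_zero.1 hv).isUnit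

/-- The determinant of the homogeneous coordinates of the vertices with the `j`-th vertex replaced
by `u`, as a linear form in `u`; it vanishes on the facet opposite to the `j`-th vertex. -/
def facetForm (v : Fin (d + 1) → Pt d) (j : Fin (d + 1)) : (Fin (d + 1) → ℝ) →ₗ[ℝ] ℝ :=
  LinearMap.proj j ∘ₗ (homMatrix v).transpose.cramer

lemma facetForm_eq_det (v : Fin (d + 1) → Pt d) (j : Fin (d + 1)) (u : Fin (d + 1) → ℝ) :
    facetForm v j u = ((homMatrix v).updateRow j u).det :=
  Matrix.cramer_transpose_apply _ _ _

lemma facetForm_self (v : Fin (d + 1) → Pt d) (j : Fin (d + 1)) :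
    facetForm v j (homPoint (v j)) = (homMatrix v).det := by
  rw [facetForm_eq_det, ← homMatrix_apply v j, Matrix.updateRow_eq_self]

lemma facetForm_of_ne (v : Fin (d + 1) → Pt d) {i j : Fin (d + 1)} (h : i ≠ j) :
    facetForm v j (homPoint (v i)) = 0 := by
  rw [facetForm_eq_det]
  exact Matrix.det_updateRow_eq_zero h

lemma facetForm_vecMul (v : Fin (d + 1) → Pt d) (j : Fin (d + 1)) (w : Fin (d + 1) → ℝ) :
    facetForm v j (Matrix.vecMul w (homMatrix v)) = (homMatrix v).det * w j := by
  rw [facetForm, LinearMap.comp_apply, LinearMap.proj_apply, ← Matrix.mulVec_transpose,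
    Matrix.cramer_eq_adjugate_mulVec, Matrix.mulVec_mulVec, Matrix.adjugate_mul,
    Matrix.det_transpose, Matrix.smul_mulVec, Matrix.one_mulVec, Pi.smul_apply, smul_eq_mul]

lemma vecMul_facetForm (v : Fin (d + 1) → Pt d) (u : Fin (d + 1) → ℝ) :
    Matrix.vecMul (fun j => facetForm v j u) (homMatrix v) = (homMatrix v).det • u := by
  rw [← Matrix.mulVec_transpose, ← Matrix.det_transpose]
  exact Matrix.mulVec_cramer _ u

lemma sum_facetForm (v : Fin (d + 1) → Pt d) (u : Fin (d + 1) → ℝ) :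
    ∑ j, facetForm v j u = (homMatrix v).det * u 0 := by
  simpa [vecMul_homMatrix] using congrFun (vecMul_facetForm v u) 0

/-! ### Simplices and their volume -/

lemma simplex_eq_image_stdSimplex (v : Fin (d + 1) → Pt d) :
    simplex v = Fintype.linearCombination ℝ v '' stdSimplex ℝ (Fin (d + 1)) := by
  rw [← convexHull_rangle_single_eq_stdSimplex, (Fintype.linearCombination ℝ v).image_convexHull,
    ← Set.range_comp]
  simp only [Function.comp_def, Fintype.linearCombination_apply_single, one_smul, simplex]

lemma isCompact_simplex (v : Fin (d + 1) → Pt d) : IsCompact (simplex v) :=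
  (Set.finite_range v).isCompact_convexHull (𝕜 := ℝ)

lemma measurableSet_simplex (v : Fin (d + 1) → Pt d) : MeasurableSet (simplex v) :=
  (isCompact_simplex v).measurableSet

/-- A nondegenerate simplex as an affine basis. -/
def simplexBasis (v : Fin (d + 1) → Pt d) (hv : AffineIndependent ℝ v) :
    AffineBasis (Fin (d + 1)) ℝ (Pt d) :=
  ⟨v, hv, by rw [hv.affineSpan_eq_top_iff_card_eq_finrank_add_one]; simp⟩

lemma facetForm_homPoint {v : Fin (d + 1) → Pt d} (hv : AffineIndependent ℝ v) (y : Pt d)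
    (j : Fin (d + 1)) :
    facetForm v j (homPoint y) = (homMatrix v).det * (simplexBasis v hv).coord j y := by
  have hcoord : Matrix.vecMul (fun i => (simplexBasis v hv).coord i y) (homMatrix v) = homPoint y :=
    vecMul_homMatrix_eq_homPoint_iff.2 ⟨(simplexBasis v hv).sum_coord_apply_eq_one y,
      (simplexBasis v hv).linear_combination_coord_eq_self y⟩
  rw [← hcoord, facetForm_vecMul]

lemma mem_interior_simplex_iff {v : Fin (d + 1) → Pt d} (hv : AffineIndependent ℝ v) {y : Pt d} :
    y ∈ interior (simplex v) ↔ ∀ j, 0 < (homMatrix v).det * facetForm v j (homPoint y) := by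
  have hdet := mul_self_pos.2 (affineIndependent_iff_det_homMatrix_ne_zero.1 hv)
  simp_rw [facetForm_homPoint hv, ← mul_assoc, mul_pos_iff_of_pos_left hdet]
  exact Set.ext_iff.1 (simplexBasis v hv).interior_convexHull y

/-- The corner simplex `{u ≥ 0, ∑ u ≤ 1}`, in terms of which volumes of simplices are computed. -/
def corner (d : ℕ) : Set (Fin d → ℝ) := {u | (∀ i, 0 ≤ u i) ∧ ∑ i, u i ≤ 1}

lemma measurableSet_corner (d : ℕ) : MeasurableSet (corner d) := by
  unfold corner
  measurability

lemma cons_mem_corner_iff {s : ℝ} {u : Fin d → ℝ} :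
    (Fin.cons s u : Fin (d + 1) → ℝ) ∈ corner (d + 1) ↔
      0 ≤ s ∧ (∀ i, 0 ≤ u i) ∧ s + ∑ i, u i ≤ 1 := by
  simp [corner, Fin.forall_fin_succ, Fin.sum_univ_succ, and_assoc]

open scoped Pointwise in
lemma corner_slice_eq_smul {s : ℝ} (h0 : 0 ≤ s) (h1 : s < 1) :
    {u : Fin d → ℝ | Fin.cons s u ∈ corner (d + 1)} = (1 - s) • corner d := by
  have hs : 0 < 1 - s := sub_pos.2 h1
  ext u
  rw [Set.mem_ofPred_eq, cons_mem_corner_iff]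
  simp only [h0, true_and, Set.mem_ofPred_eq,
    Set.mem_smul_set_iff_inv_smul_mem₀ hs.ne', corner, Pi.smul_apply, smul_eq_mul,
    ← Finset.mul_sum, inv_mul_le_iff₀ hs, mul_one, le_sub_iff_add_le',
    mul_nonneg_iff_of_pos_left (inv_pos.2 hs)]

lemma corner_slice_eq_empty {s : ℝ} (hs : s ∉ Set.Icc (0 : ℝ) 1) :
    {u : Fin d → ℝ | Fin.cons s u ∈ corner (d + 1)} = ∅ := by
  refine Set.eq_empty_of_forall_notMem fun u hu => hs ?_
  obtain ⟨h0, hu0, h1⟩ := cons_mem_corner_iff.1 hu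
  have := Finset.sum_nonneg fun i (_ : i ∈ Finset.univ) => hu0 i
  exact ⟨h0, by linarith⟩

lemma volume_corner_slice {s : ℝ} (hs : s ≠ 1) :
    volume {u : Fin d → ℝ | Fin.cons s u ∈ corner (d + 1)} =
      (Set.Icc (0 : ℝ) 1).indicator
        (fun s => ENNReal.ofReal ((1 - s) ^ d) * volume (corner d)) s := by
  by_cases hs' : s ∈ Set.Icc (0 : ℝ) 1
  · have h1 := sub_nonneg.2 hs'.2
    rw [Set.indicator_of_mem hs', corner_slice_eq_smul hs'.1 (lt_of_le_of_ne hs'.2 hs),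
      Measure.addHaar_smul, Module.finrank_fin_fun, abs_of_nonneg (by positivity)]
  · rw [Set.indicator_of_notMem hs', corner_slice_eq_empty hs', measure_empty]

lemma volume_corner_succ (d : ℕ) :
    volume (corner (d + 1)) = ENNReal.ofReal (1 / (d + 1)) * volume (corner d) := by
  have hcons := (volume_preserving_piFinSuccAbove (fun _ : Fin (d + 1) => ℝ) 0).symm
  have hpow : ∫⁻ s in Set.Icc (0 : ℝ) 1, ENNReal.ofReal ((1 - s) ^ d) =
      ENNReal.ofReal (1 / (d + 1)) := by
    rw [← ofReal_integral_eq_lintegral_ofReal (Continuous.integrableOn_Icc (by fun_prop))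
        ((ae_restrict_mem measurableSet_Icc).mono fun s hs => pow_nonneg (sub_nonneg.2 hs.2) d),
      integral_Icc_eq_integral_Ioc, ← intervalIntegral.integral_of_le zero_le_one,
      intervalIntegral.integral_comp_sub_left (fun s => s ^ d) 1]
    simp
  calc volume (corner (d + 1))
      = ∫⁻ s : ℝ, volume {u : Fin d → ℝ | Fin.cons s u ∈ corner (d + 1)} := by
        rw [← hcons.measure_preimage (measurableSet_corner (d + 1)).nullMeasurableSet,
          Measure.volume_eq_prod,
          Measure.prod_apply (hcons.measurable (measurableSet_corner (d + 1)))]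
        simp [MeasurableEquiv.piFinSuccAbove, Fin.insertNthEquiv, Set.preimage]
    _ = ∫⁻ s in Set.Icc (0 : ℝ) 1, ENNReal.ofReal ((1 - s) ^ d) * volume (corner d) := by
        rw [← lintegral_indicator measurableSet_Icc]
        refine lintegral_congr_ae ?_
        filter_upwards [compl_mem_ae_iff.2 (measure_singleton (1 : ℝ))] with s hs
        exact volume_corner_slice hs
    _ = _ := by rw [lintegral_mul_const _ (by fun_prop), hpow]

lemma volume_corner (d : ℕ) : volume (corner d) = ENNReal.ofReal (1 / d.factorial) := by
  induction d with
  | zero =>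
    have : corner 0 = Set.univ := by ext u; simp [corner]
    simp [this, volume_pi]
  | succ d ih =>
    rw [volume_corner_succ, ih, ← ENNReal.ofReal_mul (by positivity), Nat.factorial_succ]
    push_cast
    rw [one_div_mul_one_div]

lemma simplex_eq_image_corner (v : Fin (d + 1) → Pt d) :
    simplex v = (fun y => v 0 + y) ''
      (Matrix.toEuclideanLin (edgeMatrix v) '' (WithLp.ofLp ⁻¹' corner d)) := by
  have hparam : ∀ u : Pt d, v 0 + Matrix.toEuclideanLin (edgeMatrix v) u =
      Fintype.linearCombination ℝ v (Fin.cons (1 - ∑ i, u i) u.ofLp) := by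
    intro u
    ext l
    simp only [edgeMatrix, Fintype.linearCombination_apply, Fin.sum_univ_succ, PiLp.add_apply,
      Matrix.ofLp_toLpLin, Matrix.toLin'_apply, Matrix.mulVec, dotProduct, Matrix.of_apply,
      WithLp.ofLp_sum, PiLp.smul_apply, smul_eq_mul, Finset.sum_apply, Fin.cons_zero,
      Fin.cons_succ, sub_mul, one_mul, Finset.sum_sub_distrib, Finset.sum_mul,
      mul_comm (v _ _)]
    ring
  rw [simplex_eq_image_stdSimplex]
  ext y
  simp only [Set.mem_image, Set.mem_preimage, exists_exists_and_eq_and, hparam]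
  constructor
  · rintro ⟨w, ⟨hw0, hw1⟩, rfl⟩
    rw [Fin.sum_univ_succ] at hw1
    refine ⟨WithLp.toLp 2 (Fin.tail w), ⟨fun i => hw0 _, ?_⟩, ?_⟩
    · simp only [Fin.tail]
      linarith [hw0 0]
    · rw [← Fin.cons_self_tail w]
      congr 2
      simp only [Fin.tail, Fin.cons_succ]
      linarith
  · rintro ⟨u, ⟨hu0, hu1⟩, rfl⟩
    refine ⟨_, ⟨Fin.cases ?_ hu0, ?_⟩, rfl⟩
    · simp only [Fin.sum_univ_succ, Fin.cons_zero, Fin.cons_succ, sub_add_cancel]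
    · simpa only [Fin.cons_zero, sub_nonneg] using hu1

lemma volume_simplex (v : Fin (d + 1) → Pt d) :
    volume (simplex v) = ENNReal.ofReal (|(homMatrix v).det| / d.factorial) := by
  rw [simplex_eq_image_corner, Set.image_add_left, measure_preimage_add,
    Measure.addHaar_image_linearMap,
    (PiLp.volume_preserving_ofLp (Fin d)).measure_preimage
      (measurableSet_corner d).nullMeasurableSet,
    volume_corner, ← ENNReal.ofReal_mul (abs_nonneg _), det_homMatrix, mul_one_div,
    Matrix.toEuclideanLin_eq_toLin_orthonormal, LinearMap.det_toLin]

lemma simplexVolume_eq (v : Fin (d + 1) → Pt d) :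
    simplexVolume v = |(homMatrix v).det| / d.factorial := by
  rw [simplexVolume, Measure.real, volume_simplex, ENNReal.toReal_ofReal (by positivity)]

lemma simplexVolume_pos_iff {v : Fin (d + 1) → Pt d} :
    0 < simplexVolume v ↔ AffineIndependent ℝ v := by
  rw [simplexVolume_eq, affineIndependent_iff_det_homMatrix_ne_zero,
    div_pos_iff_of_pos_right (by positivity), abs_pos]

/-! ### Conservation of the total signed volume of a moving mesh -/

lemma hasDerivWithinAt_homPoint {y : ℝ → Pt d} {y' : Pt d} {S : Set ℝ} {t : ℝ}
    (h : HasDerivWithinAt y y' S t) :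
    HasDerivWithinAt (fun s => homPoint (y s)) (homDir y') S t := by
  rw [hasDerivWithinAt_pi]
  refine Fin.cases (hasDerivWithinAt_const t S (1 : ℝ)) fun i => ?_
  exact (EuclideanSpace.proj (𝕜 := ℝ) i).hasFDerivAt.comp_hasDerivWithinAt t h

/-- The determinant as a continuous multilinear map of the rows. -/
def detMultilinear (n : ℕ) : ContinuousMultilinearMap ℝ (fun _ : Fin n => Fin n → ℝ) ℝ where
  toMultilinearMap := (Matrix.detRowAlternating (n := Fin n) (R := ℝ)).toMultilinearMap
  cont := (continuous_id.matrix_det : Continuous fun A : Matrix (Fin n) (Fin n) ℝ => A.det)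

lemma hasDerivWithinAt_det_homMatrix {v : ℝ → Fin (d + 1) → Pt d} {v' : Fin (d + 1) → Pt d}
    {S : Set ℝ} {t : ℝ} (h : ∀ j, HasDerivWithinAt (fun s => v s j) (v' j) S t) :
    HasDerivWithinAt (fun s => (homMatrix (v s)).det)
      (∑ j, facetForm (v t) j (homDir (v' j))) S t := by
  have hdet := (HasFDerivWithinAt.multilinear_comp (f := detMultilinear (d + 1))
    (g := fun j s => homPoint (v s j))
    fun j => (hasDerivWithinAt_homPoint (h j)).hasFDerivWithinAt).hasDerivWithinAt
  refine hdet.congr_deriv ?_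
  simp only [_root_.sum_apply, ContinuousLinearMap.comp_apply, facetForm_eq_det]
  refine Finset.sum_congr rfl fun j _ => ?_
  simp only [ContinuousLinearMap.toSpanSingleton_apply, one_smul]
  rfl

/-- The rate of change of the volume, rewritten in terms of the motion of whole facets: this is the
form in which the contributions of two elements to a shared facet can be compared. -/
lemma sum_facetForm_homDir (v v' : Fin (d + 1) → Pt d) :
    ∑ j, facetForm v j (homDir (v' j)) =
      -∑ j, facetForm v j (∑ l ∈ Finset.univ.erase j, homDir (v' l)) := by
  rw [← sub_eq_zero, sub_neg_eq_add, ← Finset.sum_add_distrib]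
  simp_rw [← map_add, Finset.add_sum_erase _ (fun l => homDir (v' l)) (Finset.mem_univ _)]
  rw [sum_facetForm, Finset.sum_apply]
  simp only [homDir_zero, Finset.sum_const_zero, mul_zero]

lemma Nondegenerate.injective {conn : Connectivity d N Nv} {x : Config d Nv}
    (h : Nondegenerate conn x) (k : Fin N) : Function.Injective (conn k) :=
  Function.Injective.of_comp (f := x) (h k).injective

open Classical in
lemma sum_erase_eq_sum_facet {conn : Connectivity d N Nv} {k : Fin N}
    (hinj : Function.Injective (conn k)) (j : Fin (d + 1)) {A : Type*} [AddCommMonoid A]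
    (g : Fin Nv → A) :
    ∑ l ∈ Finset.univ.erase j, g (conn k l) = ∑ i ∈ (facet conn k j).toFinset, g i := by
  rw [← Finset.sum_image hinj.injOn]
  congr 1
  ext i
  rw [Set.mem_toFinset]
  simp [facet]

lemma facet_injective {conn : Connectivity d N Nv} {k : Fin N}
    (hinj : Function.Injective (conn k)) : Function.Injective (facet conn k) := fun j j' h =>
  Set.singleton_injective (compl_injective (hinj.image_injective h : ({j}ᶜ : Set _) = {j'}ᶜ))

lemma exists_perm_of_facet_eq {conn : Connectivity d N Nv} {k k' : Fin N} {j j' : Fin (d + 1)}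
    (hk : Function.Injective (conn k)) (hk' : Function.Injective (conn k'))
    (h : facet conn k' j' = facet conn k j) :
    ∃ e : Equiv.Perm (Fin (d + 1)), e j = j' ∧ ∀ l ≠ j, conn k' (e l) = conn k l := by
  let e : {l // l ≠ j} ≃ {l // l ≠ j'} := (Equiv.Set.image (conn k) _ hk).trans
    ((Equiv.setCongr h.symm).trans (Equiv.Set.image (conn k') _ hk').symm)
  refine ⟨e.extendSubtype, not_not.1 (e.extendSubtype_not_mem j (not_not.2 rfl)), fun l hl => ?_⟩
  rw [e.extendSubtype_apply_of_mem l hl]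
  exact congrArg Subtype.val ((Equiv.Set.image (conn k') _ hk').apply_symm_apply _)

lemma exists_facetForm_eq_intUnit_mul {conn : Connectivity d N Nv} {k k' : Fin N}
    {j j' : Fin (d + 1)} (hk : Function.Injective (conn k)) (hk' : Function.Injective (conn k'))
    (h : facet conn k' j' = facet conn k j) :
    ∃ ε : ℤˣ, ∀ (x : Config d Nv) (u : Fin (d + 1) → ℝ),
      facetForm (elem conn x k) j u = (ε : ℤ) * facetForm (elem conn x k') j' u := by
  obtain ⟨e, hj, he⟩ := exists_perm_of_facet_eq hk hk' h
  refine ⟨Equiv.Perm.sign e, fun x u => ?_⟩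
  rw [facetForm_eq_det, facetForm_eq_det, ← Matrix.det_permute]
  congr 1
  ext l i
  by_cases hl : l = j
  · simp [hl, hj]
  · have hel : e l ≠ j' := fun h => hl (e.injective (h.trans hj.symm))
    simp [Matrix.updateRow_apply, hl, hel, elem, he l hl]

/-- The centroid of the facet opposite to the `j`-th vertex (the origin if `d = 0`). -/
def facetCentroid (v : Fin (d + 1) → Pt d) (j : Fin (d + 1)) : Pt d :=
  (d : ℝ)⁻¹ • ∑ l ∈ Finset.univ.erase j, v l

lemma homPoint_facetCentroid (hd : d ≠ 0) (v : Fin (d + 1) → Pt d) (j : Fin (d + 1)) :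
    homPoint (facetCentroid v j) = (d : ℝ)⁻¹ • ∑ l ∈ Finset.univ.erase j, homPoint (v l) := by
  ext i
  cases i using Fin.cases <;> simp [facetCentroid, hd]

lemma facetForm_facetCentroid (hd : d ≠ 0) (v : Fin (d + 1) → Pt d) (i j : Fin (d + 1)) :
    facetForm v i (homPoint (facetCentroid v j)) =
      if i = j then 0 else (d : ℝ)⁻¹ * (homMatrix v).det := by
  rw [homPoint_facetCentroid hd, map_smul, map_sum, smul_eq_mul]
  split_ifs with hij
  · subst hij
    rw [Finset.sum_eq_zero fun l hl => facetForm_of_ne v (Finset.ne_of_mem_erase hl), mul_zero]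
  · rw [Finset.sum_eq_single_of_mem i (Finset.mem_erase.2 ⟨hij, Finset.mem_univ i⟩)
      fun l _ hl => facetForm_of_ne v hl, facetForm_self]

lemma facetForm_lineMap (v : Fin (d + 1) → Pt d) (y z : Pt d) (δ : ℝ) (j : Fin (d + 1)) :
    facetForm v j (homPoint (AffineMap.lineMap y z δ)) =
      (1 - δ) * facetForm v j (homPoint y) + δ * facetForm v j (homPoint z) := by
  rw [homPoint_lineMap, AffineMap.lineMap_apply_module, map_add, map_smul, map_smul, smul_eq_mul,
    smul_eq_mul]

lemma eventually_lineMap_facetCentroid_mem_interior (hd : d ≠ 0) {v : Fin (d + 1) → Pt d}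
    (hv : AffineIndependent ℝ v) {j : Fin (d + 1)} {z : Pt d}
    (hz : 0 < (homMatrix v).det * facetForm v j (homPoint z)) :
    ∀ᶠ δ in nhdsWithin (0 : ℝ) (Set.Ioi 0),
      AffineMap.lineMap (facetCentroid v j) z δ ∈ interior (simplex v) := by
  have hdet := mul_self_pos.2 (affineIndependent_iff_det_homMatrix_ne_zero.1 hv)
  simp only [mem_interior_simplex_iff hv, Filter.eventually_all, facetForm_lineMap,
    facetForm_facetCentroid hd]
  intro i
  by_cases hij : i = j
  · filter_upwards [self_mem_nhdsWithin] with δ hδ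
    rw [if_pos hij, mul_zero, zero_add, mul_left_comm, hij]
    exact mul_pos hδ hz
  · have hcont : ContinuousAt (fun δ : ℝ => (homMatrix v).det *
        ((1 - δ) * ((d : ℝ)⁻¹ * (homMatrix v).det) + δ * facetForm v i (homPoint z))) 0 := by
      fun_prop
    simp only [if_neg hij]
    refine (hcont.eventually (lt_mem_nhds ?_)).filter_mono nhdsWithin_le_nhds
    beta_reduce
    rw [sub_zero, one_mul, zero_mul, add_zero, mul_left_comm]
    positivity

lemma det_mul_facetForm_nonpos_of_disjoint (hd : d ≠ 0) {v v' : Fin (d + 1) → Pt d}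
    (hv : AffineIndependent ℝ v) (hv' : AffineIndependent ℝ v') {j j' : Fin (d + 1)}
    (hfacet : facetCentroid v' j' = facetCentroid v j)
    (hdisj : Disjoint (interior (simplex v')) (interior (simplex v))) :
    (homMatrix v').det * facetForm v' j' (homPoint (v j)) ≤ 0 := by
  by_contra! hpos
  have hin' := eventually_lineMap_facetCentroid_mem_interior hd hv' hpos
  have hin := eventually_lineMap_facetCentroid_mem_interior hd hv (j := j) (z := v j)
    (by rw [facetForm_self]
        exact mul_self_pos.2 (affineIndependent_iff_det_homMatrix_ne_zero.1 hv))
  rw [hfacet] at hin'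
  obtain ⟨δ, hδ', hδ⟩ := (hin'.and hin).exists
  exact Set.disjoint_left.1 hdisj hδ' hδ

lemma facetCentroid_elem_eq {conn : Connectivity d N Nv} {k k' : Fin N} {j j' : Fin (d + 1)}
    (hk : Function.Injective (conn k)) (hk' : Function.Injective (conn k'))
    (h : facet conn k' j' = facet conn k j) (x : Config d Nv) :
    facetCentroid (elem conn x k') j' = facetCentroid (elem conn x k) j := by
  classical
  simp only [facetCentroid, elem]
  rw [sum_erase_eq_sum_facet hk', sum_erase_eq_sum_facet hk]
  simp only [h]

/-- Signs `s` of the elements that orient them coherently: two elements sharing a facet induce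
opposite orientations on it, in every position of the vertices. -/
def IsCoherentOrientation (conn : Connectivity d N Nv) (s : Fin N → ℝ) : Prop :=
  ∀ k k' j j', k' ≠ k → facet conn k' j' = facet conn k j → ∀ (y : Config d Nv) u,
    s k * facetForm (elem conn y k) j u + s k' * facetForm (elem conn y k') j' u = 0

/-- Elements with a common facet lie on opposite sides of it. -/
lemma IsNonsingularMesh.isCoherentOrientation (hd : d ≠ 0) {Ω : Set (Pt d)}
    {conn : Connectivity d N Nv} {x : Config d Nv} (hx : IsNonsingularMesh Ω conn x) :
    IsCoherentOrientation conn fun k => SignType.sign (homMatrix (elem conn x k)).det := by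
  intro k k' j j' hk h y u
  have hinj := hx.nondegenerate.injective
  obtain ⟨ε, hε⟩ := exists_facetForm_eq_intUnit_mul (hinj k) (hinj k') h
  have hdet := affineIndependent_iff_det_homMatrix_ne_zero.1 (hx.nondegenerate k)
  have hdet' := affineIndependent_iff_det_homMatrix_ne_zero.1 (hx.nondegenerate k')
  have hopposite := det_mul_facetForm_nonpos_of_disjoint hd (hx.nondegenerate k)
    (hx.nondegenerate k') (facetCentroid_elem_eq (hinj k) (hinj k') h x) (hx.disjoint k' k hk)
  have hself := hε x (homPoint (elem conn x k j))
  rw [facetForm_self] at hself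
  rw [hε y u]
  generalize facetForm (elem conn x k') j' (homPoint (elem conn x k j)) = X at *
  have hX : X ≠ 0 := fun hX => hdet (by rw [hself, hX, mul_zero])
  rcases mul_neg_iff.1 (hopposite.lt_of_ne (mul_ne_zero hdet' hX)) with ⟨ha, hb⟩ | ⟨ha, hb⟩ <;>
    rcases Int.units_eq_one_or ε with rfl | rfl <;> simp [hself, sign_pos, sign_neg, ha, hb]

lemma sum_eq_zero_of_pairwise_add_eq_zero {ι : Type*} {s : Finset ι} {a : ι → ℝ}
    (hsingle : ∀ i, s = {i} → a i = 0)
    (hpair : ∀ i ∈ s, ∀ j ∈ s, i ≠ j → a i + a j = 0) : ∑ i ∈ s, a i = 0 := by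
  classical
  by_cases hcard : s.card = 1
  · obtain ⟨i, rfl⟩ := Finset.card_eq_one.1 hcard
    simpa using hsingle i rfl
  have hrow : ∀ i ∈ s, ((s.card : ℝ) - 2) * a i + ∑ j ∈ s, a j = 0 := by
    intro i hi
    have hsum : ∑ j ∈ s.erase i, (a i + a j) = 0 := Finset.sum_eq_zero fun j hj =>
      hpair i hi j (Finset.mem_of_mem_erase hj) (Finset.ne_of_mem_erase hj).symm
    rw [Finset.sum_add_distrib, Finset.sum_const, nsmul_eq_mul,
      Finset.cast_card_erase_of_mem hi] at hsum
    linarith [Finset.add_sum_erase s a hi]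
  have htotal := Finset.sum_eq_zero hrow
  rw [Finset.sum_add_distrib, ← Finset.mul_sum, Finset.sum_const, nsmul_eq_mul] at htotal
  have hfactor : (2 * ((s.card : ℝ) - 1)) * ∑ i ∈ s, a i = 0 := by linarith
  refine (mul_eq_zero.1 hfactor).resolve_left (mul_ne_zero two_ne_zero (sub_ne_zero.2 ?_))
  exact_mod_cast hcard

lemma sum_signed_volume_rate_eq_zero {conn : Connectivity d N Nv}
    (hinj : ∀ k, Function.Injective (conn k)) {s : Fin N → ℝ} (hs : IsCoherentOrientation conn s)
    (y y' : Config d Nv)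
    (hbdry : ∀ k j, IsBoundaryFacet conn k j → ∀ i ∈ facet conn k j,
      facetForm (elem conn y k) j (homDir (y' i)) = 0) :
    ∑ k, s k * ∑ j, facetForm (elem conn y k) j (homDir (elem conn y' k j)) = 0 := by
  classical
  have hfacet : ∀ k j, ∑ l ∈ Finset.univ.erase j, homDir (elem conn y' k l) =
      ∑ i ∈ (facet conn k j).toFinset, homDir (y' i) := fun k j =>
    sum_erase_eq_sum_facet (hinj k) j fun i => homDir (y' i)
  simp only [sum_facetForm_homDir, hfacet, mul_neg, Finset.sum_neg_distrib, neg_eq_zero,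
    Finset.mul_sum]
  rw [← Fintype.sum_prod_type' (f := fun k j => s k * facetForm (elem conn y k) j
      (∑ i ∈ (facet conn k j).toFinset, homDir (y' i))),
    ← Finset.sum_fiberwise Finset.univ (fun q : Fin N × Fin (d + 1) => facet conn q.1 q.2)]
  refine Finset.sum_eq_zero fun S _ => sum_eq_zero_of_pairwise_add_eq_zero ?_ ?_
  · rintro ⟨k, j⟩ hkj
    have hmem : ∀ q : Fin N × Fin (d + 1), facet conn q.1 q.2 = S ↔ q = (k, j) := fun q => by
      simpa using Finset.ext_iff.1 hkj q
    have hboundary : IsBoundaryFacet conn k j := fun k' j' hk' hf =>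
      hk' (congrArg Prod.fst ((hmem (k', j')).1 (hf.trans ((hmem (k, j)).2 rfl))))
    rw [map_sum, Finset.sum_eq_zero fun i hi => hbdry k j hboundary i (Set.mem_toFinset.1 hi),
      mul_zero]
  · rintro ⟨k, j⟩ hkj ⟨k', j'⟩ hkj' hne
    simp only [Finset.mem_filter, Finset.mem_univ, true_and] at hkj hkj'
    have hk : k' ≠ k := by
      rintro rfl
      exact hne (by rw [facet_injective (hinj k') (hkj.trans hkj'.symm)])
    simp only [hkj, hkj']
    exact hs k k' j j' hk (hkj'.trans hkj.symm) y _

lemma facetForm_eq_zero_of_dotProduct_eq_zero {v : Fin (d + 1) → Pt d} {j : Fin (d + 1)}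
    {u c : Fin (d + 1) → ℝ} (hc : c ≠ 0) (hv : ∀ l ≠ j, homPoint (v l) ⬝ᵥ c = 0)
    (hu : u ⬝ᵥ c = 0) : facetForm v j u = 0 := by
  rw [facetForm_eq_det, ← Matrix.exists_mulVec_eq_zero_iff]
  refine ⟨c, hc, funext fun l => ?_⟩
  by_cases hl : l = j
  · subst hl
    simpa [Matrix.mulVec] using hu
  · simpa [Matrix.mulVec, Matrix.updateRow_ne hl] using hv l hl

lemma homDir_dotProduct_eq_zero_of_hasDerivWithinAt {y : ℝ → Pt d} {y' : Pt d} {S : Set ℝ} {t : ℝ}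
    {c : Fin (d + 1) → ℝ} (hS : UniqueDiffWithinAt ℝ S t) (ht : t ∈ S)
    (hy : HasDerivWithinAt y y' S t) (hc : ∀ q ∈ S, homPoint (y q) ⬝ᵥ c = 0) :
    homDir y' ⬝ᵥ c = 0 := by
  have hder : HasDerivWithinAt (fun q => homPoint (y q) ⬝ᵥ c) (homDir y' ⬝ᵥ c) S t :=
    HasDerivWithinAt.fun_sum fun l _ =>
      (hasDerivWithinAt_pi.1 (hasDerivWithinAt_homPoint hy) l).mul_const (c l)
  exact hS.eq_deriv _ hder ((hasDerivWithinAt_const t S (0 : ℝ)).congr hc (hc t ht))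

/-- The motion `w` of the mesh on `[0, t]` is differentiable and keeps every boundary facet in a
fixed hyperplane, given by its homogeneous equation `c`. -/
structure IsBoundaryPreservingMotion (conn : Connectivity d N Nv) (t : ℝ) (w : ℝ → Config d Nv) :
    Prop where
  differentiableOn : ∀ i, DifferentiableOn ℝ (fun q => w q i) (Set.Icc 0 t)
  boundary : ∀ k j, IsBoundaryFacet conn k j → ∃ c : Fin (d + 1) → ℝ, c ≠ 0 ∧
    ∀ r ∈ Set.Icc 0 t, ∀ i ∈ facet conn k j, homPoint (w r i) ⬝ᵥ c = 0

theorem IsBoundaryPreservingMotion.sum_signed_volume_eq {conn : Connectivity d N Nv}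
    (hinj : ∀ k, Function.Injective (conn k)) {s : Fin N → ℝ} (hs : IsCoherentOrientation conn s)
    {t : ℝ} (ht : 0 ≤ t) {w : ℝ → Config d Nv} (hw : IsBoundaryPreservingMotion conn t w) :
    ∑ k, s k * (homMatrix (elem conn (w t) k)).det =
      ∑ k, s k * (homMatrix (elem conn (w 0) k)).det := by
  rcases ht.eq_or_lt with rfl | ht'
  · rfl
  have hunique := uniqueDiffOn_Icc ht'
  have hder : ∀ r ∈ Set.Icc 0 t, HasDerivWithinAt
      (fun q => ∑ k, s k * (homMatrix (elem conn (w q) k)).det) 0 (Set.Icc 0 t) r := by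
    intro r hr
    have hvel := fun i => (hw.differentiableOn i r hr).hasDerivWithinAt
    have hsum := HasDerivWithinAt.fun_sum fun k (_ : k ∈ Finset.univ) =>
      (hasDerivWithinAt_det_homMatrix fun j => hvel (conn k j)).const_mul (s k)
    refine hsum.congr_deriv (sum_signed_volume_rate_eq_zero hinj hs (w r)
      (fun i => derivWithin (fun q => w q i) (Set.Icc 0 t) r) fun k j hkj i hi => ?_)
    obtain ⟨c, hc, hcw⟩ := hw.boundary k j hkj
    exact facetForm_eq_zero_of_dotProduct_eq_zero hc (fun l hl => hcw r hr _ ⟨l, hl, rfl⟩)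
      (homDir_dotProduct_eq_zero_of_hasDerivWithinAt (hunique r hr) hr (hvel i)
        fun q hq => hcw q hq i hi)
  exact constant_of_derivWithin_zero (fun r hr => (hder r hr).differentiableWithinAt)
    (fun r hr => (hder r (Set.Ico_subset_Icc_self hr)).derivWithin
      (hunique r (Set.Ico_subset_Icc_self hr))) t ⟨ht, le_rfl⟩

/-! ### Projective maps -/

/-- The denominator `1 - ⟨ω, y⟩` of a projective map. -/
def projDenom (ω y : Pt d) : ℝ := 1 - inner ℝ ω y

/-- The projective map `y ↦ y / (1 - ⟨ω, y⟩)`, whose Jacobian determinant is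
`(1 - ⟨ω, y⟩)⁻⁽ᵈ⁺¹⁾`. -/
def projMap (ω y : Pt d) : Pt d := (projDenom ω y)⁻¹ • y

/-- The matrix by which a projective map acts on homogeneous coordinates (as row vectors). -/
def projMatrix (ω : Pt d) : Matrix (Fin (d + 1)) (Fin (d + 1)) ℝ :=
  Matrix.of (Fin.cons (Fin.cons 1 0) fun i => Fin.cons (-ω i) (Pi.single i 1))

lemma det_projMatrix (ω : Pt d) : (projMatrix ω).det = 1 := by
  rw [Matrix.det_succ_row_zero, Fin.sum_univ_succ]
  simp only [projMatrix, Matrix.of_apply, Fin.cons_zero, Fin.cons_succ, Pi.zero_apply, mul_zero,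
    zero_mul, Finset.sum_const_zero, add_zero, Fin.val_zero, pow_zero, one_mul]
  convert Matrix.det_one (n := Fin d) (R := ℝ) using 2
  ext i l
  simp [Matrix.one_apply, Pi.single_apply, eq_comm]

lemma homPoint_projMap {ω y : Pt d} (h : projDenom ω y ≠ 0) :
    homPoint (projMap ω y) = (projDenom ω y)⁻¹ • Matrix.vecMul (homPoint y) (projMatrix ω) := by
  ext l
  cases l using Fin.cases with
  | zero =>
    have hdenom : Matrix.vecMul (homPoint y) (projMatrix ω) 0 = projDenom ω y := by
      simp [Matrix.vecMul, dotProduct, Fin.sum_univ_succ, projMatrix, projDenom, PiLp.inner_apply,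
        sub_eq_add_neg]
    rw [Pi.smul_apply, hdenom, smul_eq_mul, inv_mul_cancel₀ h, homPoint_zero]
  | succ l =>
    simp [Matrix.vecMul, dotProduct, Fin.sum_univ_succ, projMatrix, projMap, Pi.single_apply]

lemma det_homMatrix_projMap {ω : Pt d} {v : Fin (d + 1) → Pt d}
    (h : ∀ j, projDenom ω (v j) ≠ 0) :
    (homMatrix (projMap ω ∘ v)).det =
      (∏ j, (projDenom ω (v j))⁻¹) * (homMatrix v).det := by
  have hfactor : homMatrix (projMap ω ∘ v) =
      Matrix.diagonal (fun j => (projDenom ω (v j))⁻¹) * (homMatrix v * projMatrix ω) := by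
    ext j l
    rw [Matrix.diagonal_mul, homMatrix_apply, Function.comp_apply, homPoint_projMap (h j)]
    rfl
  rw [hfactor, Matrix.det_mul, Matrix.det_mul, Matrix.det_diagonal, det_projMatrix, mul_one]

lemma projDenom_neg_projMap {ω y : Pt d} (h : projDenom ω y ≠ 0) :
    projDenom (-ω) (projMap ω y) = (projDenom ω y)⁻¹ := by
  have hinner : inner ℝ ω y = 1 - projDenom ω y := by rw [projDenom, sub_sub_cancel]
  rw [projDenom, projMap, inner_neg_left, inner_smul_right, hinner]
  field

lemma projMap_neg_projMap {ω y : Pt d} (h : projDenom ω y ≠ 0) :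
    projMap (-ω) (projMap ω y) = y := by
  rw [projMap, projDenom_neg_projMap h, inv_inv, projMap, smul_inv_smul₀ h]

lemma projDenom_linearCombination (ω : Pt d) (v : Fin (d + 1) → Pt d) {w : Fin (d + 1) → ℝ}
    (hw : ∑ j, w j = 1) :
    projDenom ω (Fintype.linearCombination ℝ v w) = ∑ j, w j * projDenom ω (v j) := by
  simp only [projDenom, mul_sub, mul_one, Finset.sum_sub_distrib, hw,
    Fintype.linearCombination_apply, inner_sum, inner_smul_right]

lemma projDenom_pos_of_mem_simplex {ω : Pt d} {v : Fin (d + 1) → Pt d}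
    (h : ∀ j, 0 < projDenom ω (v j)) {y : Pt d} (hy : y ∈ simplex v) : 0 < projDenom ω y := by
  have hconvex : Convex ℝ {y | 0 < projDenom ω y} := by
    simp only [projDenom, sub_pos]
    exact convex_halfSpace_lt (innerSL ℝ ω).isLinear 1
  have hrange : Set.range v ⊆ {y | 0 < projDenom ω y} := Set.range_subset_iff.2 h
  exact convexHull_min hrange hconvex hy

lemma projMap_mem_simplex {ω : Pt d} {v : Fin (d + 1) → Pt d}
    (h : ∀ j, 0 < projDenom ω (v j)) {y : Pt d} (hy : y ∈ simplex v) :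
    projMap ω y ∈ simplex (projMap ω ∘ v) := by
  have hpos := projDenom_pos_of_mem_simplex h hy
  rw [simplex_eq_image_stdSimplex] at hy ⊢
  obtain ⟨w, ⟨hw0, hw1⟩, rfl⟩ := hy
  have hdenom := projDenom_linearCombination ω v hw1
  set D := projDenom ω (Fintype.linearCombination ℝ v w)
  refine ⟨fun j => D⁻¹ * (w j * projDenom ω (v j)), ⟨fun j => ?_, ?_⟩, ?_⟩
  · exact mul_nonneg (inv_nonneg.2 hpos.le) (mul_nonneg (hw0 j) (h j).le)
  · rw [← Finset.mul_sum, ← hdenom, inv_mul_cancel₀ hpos.ne']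
  · change _ = D⁻¹ • Fintype.linearCombination ℝ v w
    rw [Fintype.linearCombination_apply, Fintype.linearCombination_apply, Finset.smul_sum]
    refine Finset.sum_congr rfl fun j _ => ?_
    rw [Function.comp_apply, projMap, mul_smul, mul_smul, smul_inv_smul₀ (h j).ne']

lemma image_projMap_simplex {ω : Pt d} {v : Fin (d + 1) → Pt d}
    (h : ∀ j, 0 < projDenom ω (v j)) : projMap ω '' simplex v = simplex (projMap ω ∘ v) := by
  refine Set.Subset.antisymm (Set.image_subset_iff.2 fun y => projMap_mem_simplex h) fun z hz => ?_
  have h' : ∀ j, 0 < projDenom (-ω) ((projMap ω ∘ v) j) := fun j => by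
    rw [Function.comp_apply, projDenom_neg_projMap (h j).ne']
    exact inv_pos.2 (h j)
  refine ⟨projMap (-ω) z, ?_, ?_⟩
  · simpa only [Function.comp_def, projMap_neg_projMap (h _).ne'] using projMap_mem_simplex h' hz
  · simpa only [neg_neg] using projMap_neg_projMap (projDenom_pos_of_mem_simplex h' hz).ne'

/-- The derivative of a projective map. -/
def projMapDeriv (ω y : Pt d) : Pt d →L[ℝ] Pt d :=
  (projDenom ω y)⁻¹ • (ContinuousLinearMap.id ℝ (Pt d) +
    ((projDenom ω y)⁻¹ • innerSL ℝ ω).smulRight y)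

lemma hasFDerivAt_projMap {ω y : Pt d} (h : projDenom ω y ≠ 0) :
    HasFDerivAt (projMap ω) (projMapDeriv ω y) y := by
  have hdenom : HasFDerivAt (projDenom ω) (-innerSL ℝ ω) y :=
    ((innerSL ℝ ω).hasFDerivAt (x := y)).const_sub 1
  have hinv := (hasDerivAt_inv h).comp_hasFDerivAt y hdenom
  refine (hinv.smul (hasFDerivAt_id y)).congr_fderiv ?_
  ext u : 1
  simp only [projMapDeriv, add_apply, smul_apply,
    ContinuousLinearMap.smulRight_apply, ContinuousLinearMap.id_apply, neg_apply, smul_add,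
    smul_smul, smul_eq_mul, Function.comp_apply, id_eq]
  congr 2
  field

lemma det_projMapDeriv {ω y : Pt d} (h : projDenom ω y ≠ 0) :
    (projMapDeriv ω y).det = (projDenom ω y ^ (d + 1))⁻¹ := by
  have htransvection : (projMapDeriv ω y : Pt d →ₗ[ℝ] Pt d) = (projDenom ω y)⁻¹ •
      LinearMap.transvection ((projDenom ω y)⁻¹ • (innerSL ℝ ω : Pt d →L[ℝ] ℝ).toLinearMap) y := by
    ext u : 1
    simp [projMapDeriv, LinearMap.transvection.apply]
  have hinner : innerSL ℝ ω y = 1 - projDenom ω y := (sub_sub_cancel _ _).symm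
  rw [ContinuousLinearMap.det, htransvection, LinearMap.det_smul, LinearMap.transvection.det]
  simp only [finrank_euclideanSpace, Fintype.card_fin, LinearMap.smul_apply,
    ContinuousLinearMap.coe_coe, hinner, smul_eq_mul]
  rw [pow_succ, mul_inv, inv_pow]
  congr 1
  field

lemma injOn_projMap {ω : Pt d} {s : Set (Pt d)} (h : ∀ y ∈ s, projDenom ω y ≠ 0) :
    Set.InjOn (projMap ω) s :=
  Set.LeftInvOn.injOn (f₁' := projMap (-ω)) fun y hy => projMap_neg_projMap (h y hy)

lemma setIntegral_simplex_projDenom {ω : Pt d} {v : Fin (d + 1) → Pt d}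
    (h : ∀ j, 0 < projDenom ω (v j)) :
    ∫ y in simplex v, (projDenom ω y ^ (d + 1))⁻¹ = simplexVolume (projMap ω ∘ v) := by
  have hpos : ∀ y ∈ simplex v, 0 < projDenom ω y := fun y => projDenom_pos_of_mem_simplex h
  have hchange := integral_image_eq_integral_abs_det_fderiv_smul volume (measurableSet_simplex v)
    (fun y hy => (hasFDerivAt_projMap (hpos y hy).ne').hasFDerivWithinAt)
    (injOn_projMap fun y hy => (hpos y hy).ne') fun _ => (1 : ℝ)
  rw [image_projMap_simplex h] at hchange
  rw [simplexVolume, ← setIntegral_one_eq_measureReal, hchange]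
  refine setIntegral_congr_fun (measurableSet_simplex v) fun y hy => ?_
  have := hpos y hy
  simp only [det_projMapDeriv this.ne', smul_eq_mul, mul_one]
  rw [abs_of_pos (by positivity)]

/-! ### Meshes whose boundary vertices slide along the boundary -/

/-- The homogeneous equation of the hyperplane through the facet opposite to the `j`-th vertex,
normalized to take the value `1` at that vertex. -/
def facetCovector (v : Fin (d + 1) → Pt d) (j : Fin (d + 1)) : Fin (d + 1) → ℝ :=
  fun l => (homMatrix v)⁻¹ l j

lemma homPoint_dotProduct_facetCovector {v : Fin (d + 1) → Pt d} (hv : AffineIndependent ℝ v)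
    (i j : Fin (d + 1)) :
    homPoint (v i) ⬝ᵥ facetCovector v j = (1 : Matrix (Fin (d + 1)) (Fin (d + 1)) ℝ) i j :=
  congrFun₂ (Matrix.mul_nonsing_inv _ (isUnit_homMatrix hv)) i j

lemma facetCovector_ne_zero {v : Fin (d + 1) → Pt d} (hv : AffineIndependent ℝ v)
    (j : Fin (d + 1)) : facetCovector v j ≠ 0 := fun h => by
  simpa [h] using homPoint_dotProduct_facetCovector hv j j

lemma homDir_dotProduct_eq_zero_of_mem_vectorSpan {s : Set (Pt d)} {c : Fin (d + 1) → ℝ}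
    (h : ∀ y ∈ s, homPoint y ⬝ᵥ c = 0) {u : Pt d} (hu : u ∈ vectorSpan ℝ s) :
    homDir u ⬝ᵥ c = 0 := by
  let φ : Pt d →ₗ[ℝ] ℝ :=
    { toFun u := homDir u ⬝ᵥ c
      map_add' a b := by simp [dotProduct, Fin.sum_univ_succ, add_mul, Finset.sum_add_distrib]
      map_smul' r a := by simp [dotProduct, Fin.sum_univ_succ, mul_assoc, Finset.mul_sum] }
  suffices vectorSpan ℝ s ≤ LinearMap.ker φ from this hu
  refine Submodule.span_le.2 ?_
  rintro _ ⟨y, hy, z, hz, rfl⟩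
  change homDir (y - z) ⬝ᵥ c = 0
  rw [← homPoint_sub_homPoint, sub_dotProduct, h y hy, h z hz, sub_zero]

lemma homPoint_dotProduct_eq_zero_of_sub_mem {conn : Connectivity d N Nv} {x : Config d Nv}
    {k : Fin N} {j : Fin (d + 1)} {c : Fin (d + 1) → ℝ}
    (hc : ∀ i ∈ facet conn k j, homPoint (x i) ⬝ᵥ c = 0) (hkj : IsBoundaryFacet conn k j)
    {i : Fin Nv} (hi : i ∈ facet conn k j) {y : Pt d} (hy : y - x i ∈ slideSpace conn x i) :
    homPoint y ⬝ᵥ c = 0 := by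
  simp only [slideSpace, Submodule.mem_iInf] at hy
  have hdir := homDir_dotProduct_eq_zero_of_mem_vectorSpan (Set.forall_mem_image.2 hc)
    (hy k j hkj hi)
  rwa [← homPoint_sub_homPoint, sub_dotProduct, hc i hi, sub_zero] at hdir

lemma isBoundaryPreservingMotion_of_sub_mem_slideSpace {conn : Connectivity d N Nv} {t : ℝ}
    {x : ℝ → Config d Nv} (hnd : Nondegenerate conn (x 0))
    (hx : ∀ i, DifferentiableOn ℝ (fun q => x q i) (Set.Icc 0 t))
    (hslide : ∀ r ∈ Set.Icc 0 t, ∀ i, x r i - x 0 i ∈ slideSpace conn (x 0) i) :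
    IsBoundaryPreservingMotion conn t x where
  differentiableOn := hx
  boundary k j hkj := by
    refine ⟨facetCovector (elem conn (x 0) k) j, facetCovector_ne_zero (hnd k) j,
      fun r hr i hi => homPoint_dotProduct_eq_zero_of_sub_mem ?_ hkj hi (hslide r hr i)⟩
    rintro _ ⟨l, hl, rfl⟩
    exact (homPoint_dotProduct_facetCovector (hnd k) l j).trans (Matrix.one_apply_ne hl)

/-- A projective map carries hyperplanes to hyperplanes. -/
lemma IsBoundaryPreservingMotion.comp_projMap {conn : Connectivity d N Nv} {t : ℝ}
    {w : ℝ → Config d Nv} (hw : IsBoundaryPreservingMotion conn t w) {ω : Pt d}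
    (hω : ∀ r ∈ Set.Icc 0 t, ∀ i, projDenom ω (w r i) ≠ 0) :
    IsBoundaryPreservingMotion conn t fun r i => projMap ω (w r i) where
  differentiableOn i r hr := DifferentiableAt.comp_differentiableWithinAt (g := projMap ω) r
    (hasFDerivAt_projMap (hω r hr i)).differentiableAt (hw.differentiableOn i r hr)
  boundary k j hkj := by
    obtain ⟨c, hc, hcw⟩ := hw.boundary k j hkj
    have hunit : IsUnit (projMatrix ω).det := by simp [det_projMatrix]
    have hcancel : (projMatrix ω).mulVec ((projMatrix ω)⁻¹.mulVec c) = c := by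
      rw [Matrix.mulVec_mulVec, Matrix.mul_nonsing_inv _ hunit, Matrix.one_mulVec]
    refine ⟨(projMatrix ω)⁻¹.mulVec c, fun h => hc ?_, fun r hr i hi => ?_⟩
    · rw [← hcancel, h, Matrix.mulVec_zero]
    · rw [homPoint_projMap (hω r hr i), smul_dotProduct, ← Matrix.dotProduct_mulVec, hcancel,
        hcw r hr i hi, smul_zero]

lemma continuous_det_homMatrix_elem (conn : Connectivity d N Nv) (k : Fin N) :
    Continuous fun y : Config d Nv => (homMatrix (elem conn y k)).det := by
  refine Continuous.matrix_det (continuous_matrix fun j i => ?_)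
  cases i using Fin.cases with
  | zero => exact continuous_const
  | succ i =>
    simp only [homMatrix_apply, homPoint_succ, elem]
    fun_prop

lemma sign_det_homMatrix_eq {conn : Connectivity d N Nv} {t : ℝ} {x : ℝ → Config d Nv}
    (hx : ContinuousOn x (Set.Icc 0 t)) (hnd : ∀ r ∈ Set.Icc 0 t, Nondegenerate conn (x r))
    (k : Fin N) {r : ℝ} (hr : r ∈ Set.Icc 0 t) :
    SignType.sign (homMatrix (elem conn (x r) k)).det =
      SignType.sign (homMatrix (elem conn (x 0) k)).det := by
  have hdet : ContinuousOn (fun q => (homMatrix (elem conn (x q) k)).det) (Set.Icc 0 t) :=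
    (continuous_det_homMatrix_elem conn k).comp_continuousOn hx
  refine isPreconnected_Icc.constant
    (f := fun q => SignType.sign (homMatrix (elem conn (x q) k)).det)
    (fun q hq => ?_) hr ⟨le_rfl, hr.1.trans hr.2⟩
  exact ContinuousAt.comp_continuousWithinAt (f := fun q => (homMatrix (elem conn (x q) k)).det)
    (continuousAt_sign_of_ne_zero (affineIndependent_iff_det_homMatrix_ne_zero.1 (hnd q hq k)))
    (hdet q hq)

lemma setIntegral_simplex_projDenom_eq_mul_det {ω : Pt d} {v : Fin (d + 1) → Pt d}
    (h : ∀ j, 0 < projDenom ω (v j)) :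
    ∫ y in simplex v, (projDenom ω y ^ (d + 1))⁻¹ =
      SignType.sign (homMatrix v).det * (homMatrix (projMap ω ∘ v)).det / d.factorial := by
  rw [setIntegral_simplex_projDenom h, simplexVolume_eq, ← sign_mul_self,
    det_homMatrix_projMap fun j => (h j).ne', sign_mul,
    sign_pos (Finset.prod_pos fun j _ => inv_pos.2 (h j)), one_mul]

/-- The integrals over the moving mesh of the Jacobian determinant of a projective map are the
volumes of the projected mesh, whose boundary vertices again slide along hyperplanes. -/
theorem sum_setIntegral_projDenom_eq (hd : d ≠ 0) {Ω : Set (Pt d)}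
    {conn : Connectivity d N Nv} {t : ℝ} (ht : 0 ≤ t) {x : ℝ → Config d Nv}
    (h₀ : IsNonsingularMesh Ω conn (x 0)) (hx : IsBoundaryPreservingMotion conn t x)
    (hnd : ∀ r ∈ Set.Icc 0 t, Nondegenerate conn (x r))
    {ω : Pt d} (hω : ∀ r ∈ Set.Icc 0 t, ∀ i, 0 < projDenom ω (x r i)) :
    ∑ k, ∫ y in simplex (elem conn (x t) k), (projDenom ω y ^ (d + 1))⁻¹ =
      ∑ k, ∫ y in simplex (elem conn (x 0) k), (projDenom ω y ^ (d + 1))⁻¹ := by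
  have hcont : ContinuousOn x (Set.Icc 0 t) :=
    continuousOn_pi.2 fun i => (hx.differentiableOn i).continuousOn
  have hconserved := (hx.comp_projMap fun r hr i => (hω r hr i).ne').sum_signed_volume_eq
    h₀.nondegenerate.injective (h₀.isCoherentOrientation hd) ht
  have hintegral : ∀ r ∈ Set.Icc 0 t, ∀ k,
      ∫ y in simplex (elem conn (x r) k), (projDenom ω y ^ (d + 1))⁻¹ =
        SignType.sign (homMatrix (elem conn (x 0) k)).det *
          (homMatrix (elem conn (fun i => projMap ω (x r i)) k)).det / d.factorial := by
    intro r hr k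
    have hpos : ∀ j, 0 < projDenom ω (elem conn (x r) k j) := fun j => hω r hr (conn k j)
    rw [setIntegral_simplex_projDenom_eq_mul_det hpos, sign_det_homMatrix_eq hcont hnd k hr]
    rfl
  simp only [hintegral t ⟨ht, le_rfl⟩, hintegral 0 ⟨le_rfl, ht⟩, ← Finset.sum_div]
  rw [hconserved]

/-! ### Measures are determined by the integrals of projective Jacobians -/

section Moments

variable {α β : Type*} [MeasurableSpace α] [MeasurableSpace β] {μ : Measure α} {ν : Measure β}
  [IsFiniteMeasure μ] [IsFiniteMeasure ν]

lemma hasSum_mul_integral_pow {𝕜 : Type*} [RCLike 𝕜] {f : α → ℝ}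
    (hf : AEStronglyMeasurable f μ) {ρ : ℝ} (hρ : ∀ᵐ a ∂μ, |f a| ≤ ρ) {c : ℕ → 𝕜}
    (hc : Summable fun n => ‖c n‖ * ρ ^ n) :
    HasSum (fun n => c n * ((∫ a, f a ^ n ∂μ : ℝ) : 𝕜)) (∫ a, ∑' n, c n * (f a : 𝕜) ^ n ∂μ) := by
  have hbound : ∀ n : ℕ, ∀ᵐ a ∂μ, ‖c n * (f a : 𝕜) ^ n‖ ≤ ‖c n‖ * ρ ^ n := by
    intro n
    filter_upwards [hρ] with a ha
    rw [norm_mul, norm_pow, RCLike.norm_ofReal]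
    gcongr
  have hintegrable : ∀ n : ℕ, Integrable (fun a => c n * (f a : 𝕜) ^ n) μ := fun n =>
    Integrable.of_bound
      (((RCLike.continuous_ofReal.comp_aestronglyMeasurable hf).pow n).const_mul (c n)) _ (hbound n)
  have hterm : ∀ n, ∫ a, c n * (f a : 𝕜) ^ n ∂μ = c n * ((∫ a, f a ^ n ∂μ : ℝ) : 𝕜) := by
    intro n
    rw [integral_const_mul, ← integral_ofReal]
    simp only [RCLike.ofReal_pow]
  simp only [← hterm]
  refine hasSum_integral_of_summable_integral_norm hintegrable ?_
  refine Summable.of_nonneg_of_le (fun n => integral_nonneg fun a => norm_nonneg _) (fun n => ?_)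
    (hc.mul_left (μ.real Set.univ))
  simpa using integral_mono_ae (hintegrable n).norm (integrable_const _) (hbound n)

lemma hasSum_integral_inv_one_sub_pow (m : ℕ) {f : α → ℝ} (hf : AEStronglyMeasurable f μ) {ρ : ℝ}
    (hρ : ∀ᵐ a ∂μ, |f a| ≤ ρ) {z : ℝ} (hz : |z * ρ| < 1) :
    HasSum (fun n : ℕ => z ^ n * (((n + m).choose m : ℝ) * ∫ a, f a ^ n ∂μ))
      (∫ a, ((1 - z * f a) ^ (m + 1))⁻¹ ∂μ) := by
  have hρ' : ∀ᵐ a ∂μ, |f a| ≤ |ρ| := hρ.mono fun a ha => ha.trans (le_abs_self ρ)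
  have hsum : Summable fun n : ℕ => ‖((n + m).choose m : ℝ) * z ^ n‖ * |ρ| ^ n := by
    have hnorm : ‖|z * ρ|‖ < 1 := by rwa [Real.norm_eq_abs, abs_abs]
    refine (hasSum_choose_mul_geometric_of_norm_lt_one m hnorm).summable.congr fun n => ?_
    rw [norm_mul, norm_pow, Real.norm_natCast, Real.norm_eq_abs, abs_mul, mul_pow, mul_assoc]
  have hseries : ∀ᵐ a ∂μ, ∑' n, ((n + m).choose m : ℝ) * z ^ n * f a ^ n =
      ((1 - z * f a) ^ (m + 1))⁻¹ := by
    filter_upwards [hρ'] with a ha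
    have hlt : ‖z * f a‖ < 1 := by
      rw [norm_mul, Real.norm_eq_abs, Real.norm_eq_abs]
      exact (mul_le_mul_of_nonneg_left ha (abs_nonneg z)).trans_lt (abs_mul z ρ ▸ hz)
    rw [← one_div, ← (hasSum_choose_mul_geometric_of_norm_lt_one m hlt).tsum_eq]
    exact tsum_congr fun n => by rw [mul_pow, mul_assoc]
  have hmoments := hasSum_mul_integral_pow (𝕜 := ℝ) hf hρ' hsum
  simp only [RCLike.ofReal_real_eq_id, id_eq] at hmoments
  rw [integral_congr_ae hseries] at hmoments
  simpa only [mul_comm, mul_assoc, mul_left_comm] using hmoments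

lemma hasFPowerSeriesAt_integral_inv_one_sub_pow (m : ℕ) {f : α → ℝ}
    (hf : AEStronglyMeasurable f μ) {ρ : ℝ} (hρ : ∀ᵐ a ∂μ, |f a| ≤ ρ) :
    HasFPowerSeriesAt (fun z => ∫ a, ((1 - z * f a) ^ (m + 1))⁻¹ ∂μ)
      (FormalMultilinearSeries.ofScalars ℝ
        fun n => ((n + m).choose m : ℝ) * ∫ a, f a ^ n ∂μ) 0 := by
  have hsmall : ∀ᶠ z in nhds (0 : ℝ), |z * ρ| < 1 := by
    have hcont : ContinuousAt (fun z : ℝ => |z * ρ|) 0 := by fun_prop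
    exact hcont.eventually (gt_mem_nhds (by simp))
  rw [hasFPowerSeriesAt_iff]
  filter_upwards [hsmall] with z hz
  simpa only [zero_add, FormalMultilinearSeries.coeff_ofScalars, smul_eq_mul] using
    hasSum_integral_inv_one_sub_pow m hf hρ hz

lemma integral_pow_eq_of_integral_inv_one_sub_pow_eq (m : ℕ) {f : α → ℝ} {g : β → ℝ}
    (hf : AEStronglyMeasurable f μ) (hg : AEStronglyMeasurable g ν) {ρ : ℝ}
    (hfρ : ∀ᵐ a ∂μ, |f a| ≤ ρ) (hgρ : ∀ᵐ a ∂ν, |g a| ≤ ρ)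
    (h : ∀ᶠ z in nhds (0 : ℝ), ∫ a, ((1 - z * f a) ^ (m + 1))⁻¹ ∂μ =
      ∫ a, ((1 - z * g a) ^ (m + 1))⁻¹ ∂ν) (n : ℕ) :
    ∫ a, f a ^ n ∂μ = ∫ a, g a ^ n ∂ν := by
  have hseries := (hasFPowerSeriesAt_integral_inv_one_sub_pow m hf hfρ)
    |>.eq_formalMultilinearSeries_of_eventually
      (hasFPowerSeriesAt_integral_inv_one_sub_pow m hg hgρ) h
  have hcoeff := congrArg (fun q => FormalMultilinearSeries.coeff q n) hseries
  simp only [FormalMultilinearSeries.coeff_ofScalars] at hcoeff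
  have hchoose : ((n + m).choose m : ℝ) ≠ 0 := by
    exact_mod_cast (Nat.choose_pos (Nat.le_add_left m n)).ne'
  exact mul_left_cancel₀ hchoose hcoeff

end Moments

section BoundedSupport

variable {E : Type*} [NormedAddCommGroup E] [InnerProductSpace ℝ E] [MeasurableSpace E]
  {μ ν : Measure E} {R : ℝ}

lemma ae_abs_inner_le (hμ : ∀ᵐ y ∂μ, ‖y‖ ≤ R) (ω : E) : ∀ᵐ y ∂μ, |inner ℝ ω y| ≤ ‖ω‖ * R := by
  filter_upwards [hμ] with y hy
  exact (abs_real_inner_le_norm ω y).trans (mul_le_mul_of_nonneg_left hy (norm_nonneg ω))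

variable [BorelSpace E] [IsFiniteMeasure μ] [IsFiniteMeasure ν]

lemma hasSum_charFun (hμ : ∀ᵐ y ∂μ, ‖y‖ ≤ R) (ω : E) :
    HasSum (fun n : ℕ => Complex.I ^ n / n.factorial * ((∫ y, inner ℝ ω y ^ n ∂μ : ℝ) : ℂ))
      (charFun μ ω) := by
  have hsum : Summable fun n : ℕ => ‖Complex.I ^ n / (n.factorial : ℂ)‖ * (‖ω‖ * R) ^ n := by
    refine (Real.summable_pow_div_factorial (‖ω‖ * R)).congr fun n => ?_
    simp only [norm_div, norm_pow, Complex.norm_I, one_pow, Complex.norm_natCast]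
    ring
  have hexp : ∀ y : E, ∑' n : ℕ, Complex.I ^ n / n.factorial * (inner ℝ ω y : ℂ) ^ n =
      Complex.exp (inner ℝ y ω * Complex.I) := by
    intro y
    rw [real_inner_comm ω y, Complex.exp_eq_exp_ℂ,
      ← (NormedSpace.expSeries_div_hasSum_exp ((inner ℝ ω y : ℂ) * Complex.I)).tsum_eq]
    exact tsum_congr fun n => by ring
  have hmoments := hasSum_mul_integral_pow (𝕜 := ℂ) (f := fun y => inner ℝ ω y)
    (continuous_const.inner continuous_id).aestronglyMeasurable (ae_abs_inner_le hμ ω) hsum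
  simp only [charFun_apply, ← hexp]
  exact hmoments

theorem measure_eq_of_integral_inv_one_sub_inner_pow_eq [SecondCountableTopology E]
    [CompleteSpace E] (m : ℕ)
    (hμ : ∀ᵐ y ∂μ, ‖y‖ ≤ R) (hν : ∀ᵐ y ∂ν, ‖y‖ ≤ R)
    (h : ∀ ω : E, ‖ω‖ * R < 1 →
      ∫ y, ((1 - inner ℝ ω y) ^ (m + 1))⁻¹ ∂μ = ∫ y, ((1 - inner ℝ ω y) ^ (m + 1))⁻¹ ∂ν) :
    μ = ν := by
  refine Measure.ext_of_charFun (funext fun ω => ?_)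
  have hmeas : ∀ ρ : Measure E, AEStronglyMeasurable (fun y => inner ℝ ω y) ρ := fun ρ =>
    (continuous_const.inner continuous_id).aestronglyMeasurable
  have hsmall : ∀ᶠ z : ℝ in nhds 0, ‖z • ω‖ * R < 1 := by
    have hcont : ContinuousAt (fun z : ℝ => ‖z • ω‖ * R) 0 := by fun_prop
    exact hcont.eventually (gt_mem_nhds (by simp))
  have hmoments := integral_pow_eq_of_integral_inv_one_sub_pow_eq m (hmeas μ) (hmeas ν)
    (ae_abs_inner_le hμ ω) (ae_abs_inner_le hν ω) (hsmall.mono fun z hz => by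
      simpa only [inner_smul_left, conj_trivial] using h (z • ω) hz)
  have hcharFun := hasSum_charFun hν ω
  simp only [← hmoments] at hcharFun
  exact (hasSum_charFun hμ ω).unique hcharFun

end BoundedSupport

/-! ### Nonsingularity is a property of the sum of the volumes restricted to the elements -/

section SumRestrict

variable {X ι : Type*} [Fintype ι] [MeasurableSpace X] {μ : Measure X} {s : ι → Set X} {C : Set X}

lemma sum_measure_inter_eq (h : ∑ k, μ.restrict (s k) = μ.restrict C) {A : Set X}
    (hA : MeasurableSet A) : ∑ k, μ (A ∩ s k) = μ (A ∩ C) := by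
  simpa [Measure.restrict_apply hA] using congrArg (· A) h

variable [TopologicalSpace X] [OpensMeasurableSpace X] [μ.IsOpenPosMeasure]

lemma disjoint_interior_of_sum_restrict_eq (h : ∑ k, μ.restrict (s k) = μ.restrict C)
    {k l : ι} (hkl : k ≠ l) (hk : μ (s k) ≠ ⊤) : Disjoint (interior (s k)) (interior (s l)) := by
  classical
  have hopen : IsOpen (interior (s k) ∩ interior (s l)) := isOpen_interior.inter isOpen_interior
  rw [Set.disjoint_iff_inter_eq_empty, ← hopen.measure_eq_zero_iff μ]
  set U := interior (s k) ∩ interior (s l)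
  have hUk : U ⊆ s k := Set.inter_subset_left.trans interior_subset
  have hUl : U ⊆ s l := Set.inter_subset_right.trans interior_subset
  have hdouble : μ U + μ U ≤ μ U :=
    calc μ U + μ U = ∑ m ∈ {k, l}, μ (U ∩ s m) := by
          rw [Finset.sum_pair hkl, Set.inter_eq_left.2 hUk, Set.inter_eq_left.2 hUl]
      _ ≤ ∑ m, μ (U ∩ s m) := Finset.sum_le_sum_of_subset (Finset.subset_univ _)
      _ = μ (U ∩ C) := sum_measure_inter_eq h hopen.measurableSet
      _ ≤ μ U := measure_mono Set.inter_subset_left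
  by_contra hne
  exact hdouble.not_gt (ENNReal.lt_add_right (measure_ne_top_of_subset hUk hk) hne)

lemma subset_of_sum_restrict_eq (h : ∑ k, μ.restrict (s k) = μ.restrict C) (hC : IsClosed C)
    {k : ι} (hk : s k ⊆ closure (interior (s k))) : s k ⊆ C := by
  refine hk.trans (closure_minimal ?_ hC)
  have hopen : IsOpen (interior (s k) \ C) := isOpen_interior.sdiff hC
  rw [← Set.sdiff_eq_empty, ← hopen.measure_eq_zero_iff μ]
  have hsum := sum_measure_inter_eq h hopen.measurableSet
  rw [Set.sdiff_inter_self, measure_empty, Finset.sum_eq_zero_iff_of_nonneg fun _ _ => zero_le]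
    at hsum
  simpa only [Set.inter_eq_left.2 (Set.sdiff_subset.trans interior_subset)] using
    hsum k (Finset.mem_univ k)

lemma subset_iUnion_of_sum_restrict_eq (h : ∑ k, μ.restrict (s k) = μ.restrict C)
    (hs : ∀ k, IsClosed (s k)) {U : Set X} (hU : IsOpen U) (hUC : U ⊆ C) : U ⊆ ⋃ k, s k := by
  have hopen : IsOpen (U \ ⋃ k, s k) := hU.sdiff (isClosed_iUnion_of_finite hs)
  rw [← Set.sdiff_eq_empty, ← hopen.measure_eq_zero_iff μ]
  have hsum := sum_measure_inter_eq h hopen.measurableSet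
  rw [Set.inter_eq_left.2 (Set.sdiff_subset.trans hUC)] at hsum
  refine hsum.symm.trans (Finset.sum_eq_zero fun k _ => ?_)
  have hempty : (U \ ⋃ k, s k) ∩ s k = ∅ :=
    (Set.disjoint_sdiff_left.mono_right (Set.subset_iUnion s k)).inter_eq
  rw [hempty, measure_empty]

end SumRestrict

/-- The sum of the volume measures restricted to the elements. -/
def meshMeasure (conn : Connectivity d N Nv) (x : Config d Nv) : Measure (Pt d) :=
  ∑ k, volume.restrict (simplex (elem conn x k))

instance (conn : Connectivity d N Nv) (x : Config d Nv) : IsFiniteMeasure (meshMeasure conn x) := by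
  have : ∀ k, IsFiniteMeasure (volume.restrict (simplex (elem conn x k))) := fun k =>
    isFiniteMeasure_restrict.2 (isCompact_simplex _).measure_lt_top.ne
  unfold meshMeasure
  infer_instance

lemma volume_frontier_simplex (v : Fin (d + 1) → Pt d) : volume (frontier (simplex v)) = 0 :=
  (convex_convexHull ℝ _).addHaar_frontier volume

lemma IsNonsingularMesh.meshMeasure_eq {Ω : Set (Pt d)} {conn : Connectivity d N Nv}
    {x : Config d Nv} (h : IsNonsingularMesh Ω conn x) :
    meshMeasure conn x = volume.restrict (closure Ω) := by
  rw [← h.cover, Measure.restrict_iUnion_ae (fun k l hkl => ?_)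
    fun k => (measurableSet_simplex _).nullMeasurableSet, Measure.sum_fintype, meshMeasure]
  have hinterior : ∀ k, simplex (elem conn x k) =ᵐ[volume] interior (simplex (elem conn x k)) :=
    fun k => (interior_ae_eq_of_null_frontier (volume_frontier_simplex _)).symm
  exact (h.disjoint k l hkl).aedisjoint.congr (hinterior k) (hinterior l)

lemma simplex_subset_closure_interior {v : Fin (d + 1) → Pt d} (hv : AffineIndependent ℝ v) :
    simplex v ⊆ closure (interior (simplex v)) := by
  have hnonempty : (interior (simplex v)).Nonempty :=
    ⟨_, (simplexBasis v hv).centroid_mem_interior_convexHull⟩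
  exact subset_closure.trans
    ((convex_convexHull ℝ _).closure_interior_eq_closure_of_nonempty_interior hnonempty).ge

lemma isNonsingularMesh_of_meshMeasure_eq {Ω : Set (Pt d)} (hΩ : IsOpen Ω)
    {conn : Connectivity d N Nv} {x : Config d Nv} (hx : Nondegenerate conn x)
    (h : meshMeasure conn x = volume.restrict (closure Ω)) : IsNonsingularMesh Ω conn x where
  nondegenerate := hx
  disjoint _ _ hkl :=
    disjoint_interior_of_sum_restrict_eq h hkl (isCompact_simplex _).measure_lt_top.ne
  cover := by
    have hclosed : ∀ k, IsClosed (simplex (elem conn x k)) :=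
      fun k => (isCompact_simplex _).isClosed
    refine Set.Subset.antisymm (Set.iUnion_subset fun k => ?_)
      (closure_minimal ?_ (isClosed_iUnion_of_finite hclosed))
    · exact subset_of_sum_restrict_eq h isClosed_closure (simplex_subset_closure_interior (hx k))
    · exact subset_iUnion_of_sum_restrict_eq h hclosed hΩ subset_closure

lemma ae_meshMeasure_norm_le {conn : Connectivity d N Nv} {x : Config d Nv} {R : ℝ}
    (h : ∀ i, ‖x i‖ ≤ R) : ∀ᵐ y ∂(meshMeasure conn x), ‖y‖ ≤ R := by
  simp only [meshMeasure, ae_finsetSum_measure_iff]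
  intro k _
  refine ae_restrict_of_forall_mem (measurableSet_simplex _) fun y hy => ?_
  have hball : simplex (elem conn x k) ⊆ Metric.closedBall 0 R := by
    refine convexHull_min (Set.range_subset_iff.2 fun j => ?_) (convex_closedBall 0 R)
    exact mem_closedBall_zero_iff.2 (h (conn k j))
  exact mem_closedBall_zero_iff.1 (hball hy)

lemma integral_meshMeasure_projDenom {conn : Connectivity d N Nv} {x : Config d Nv} {ω : Pt d}
    (hω : ∀ i, 0 < projDenom ω (x i)) :
    ∫ y, (projDenom ω y ^ (d + 1))⁻¹ ∂(meshMeasure conn x) =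
      ∑ k, ∫ y in simplex (elem conn x k), (projDenom ω y ^ (d + 1))⁻¹ := by
  refine integral_finsetSum_measure fun k _ => ?_
  have hcont : Continuous fun y => projDenom ω y ^ (d + 1) := by
    unfold projDenom
    fun_prop
  exact (hcont.continuousOn.inv₀ fun y hy => pow_ne_zero _
    (projDenom_pos_of_mem_simplex (fun j => hω (conn k j)) hy).ne').integrableOn_compact
      (isCompact_simplex _)

theorem IsNonsingularMesh.of_isBoundaryPreservingMotion (hd : d ≠ 0) {Ω : Set (Pt d)}
    (hΩ : IsOpen Ω) {conn : Connectivity d N Nv} {t : ℝ} (ht : 0 ≤ t) {x : ℝ → Config d Nv}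
    (h₀ : IsNonsingularMesh Ω conn (x 0)) (hx : IsBoundaryPreservingMotion conn t x)
    (hnd : ∀ r ∈ Set.Icc 0 t, Nondegenerate conn (x r)) :
    IsNonsingularMesh Ω conn (x t) := by
  have h0t : (0 : ℝ) ∈ Set.Icc 0 t := ⟨le_rfl, ht⟩
  have htt : t ∈ Set.Icc 0 t := ⟨ht, le_rfl⟩
  have hcont : ContinuousOn x (Set.Icc 0 t) :=
    continuousOn_pi.2 fun i => (hx.differentiableOn i).continuousOn
  obtain ⟨R, hR⟩ : ∃ R, ∀ r ∈ Set.Icc 0 t, ∀ i, ‖x r i‖ ≤ R := by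
    obtain ⟨R, hR⟩ := isCompact_Icc.exists_bound_of_continuousOn hcont
    exact ⟨R, fun r hr i => (norm_le_pi_norm (x r) i).trans (hR r hr)⟩
  refine isNonsingularMesh_of_meshMeasure_eq hΩ (hnd t htt) ?_
  rw [← h₀.meshMeasure_eq]
  refine measure_eq_of_integral_inv_one_sub_inner_pow_eq d (ae_meshMeasure_norm_le (hR t htt))
    (ae_meshMeasure_norm_le (hR 0 h0t)) fun ω hω => ?_
  have hpos : ∀ r ∈ Set.Icc 0 t, ∀ i, 0 < projDenom ω (x r i) := fun r hr i =>
    sub_pos.2 ((real_inner_le_norm ω (x r i)).trans_lt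
      ((mul_le_mul_of_nonneg_left (hR r hr i) (norm_nonneg ω)).trans_lt hω))
  calc ∫ y, (projDenom ω y ^ (d + 1))⁻¹ ∂(meshMeasure conn (x t))
      = ∑ k, ∫ y in simplex (elem conn (x t) k), (projDenom ω y ^ (d + 1))⁻¹ :=
        integral_meshMeasure_projDenom (hpos t htt)
    _ = ∑ k, ∫ y in simplex (elem conn (x 0) k), (projDenom ω y ^ (d + 1))⁻¹ :=
        sum_setIntegral_projDenom_eq hd ht h₀ hx hnd hpos
    _ = ∫ y, (projDenom ω y ^ (d + 1))⁻¹ ∂(meshMeasure conn (x 0)) :=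
        (integral_meshMeasure_projDenom (hpos 0 h0t)).symm

/-! ### Trajectories of the moving mesh equation -/

lemma sub_mem_of_hasDerivWithinAt_mem {E : Type*} [NormedAddCommGroup E] [InnerProductSpace ℝ E]
    {V : Submodule ℝ E} [V.HasOrthogonalProjection] {t : ℝ} {y y' : ℝ → E}
    (hy : ∀ r ∈ Set.Icc 0 t, HasDerivWithinAt y (y' r) (Set.Icc 0 t) r)
    (hV : ∀ r ∈ Set.Icc 0 t, y' r ∈ V) {r : ℝ} (hr : r ∈ Set.Icc 0 t) : y r - y 0 ∈ V := by
  rw [← V.orthogonal_orthogonal, Submodule.mem_orthogonal]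
  intro w hw
  rcases (hr.1.trans hr.2).eq_or_lt with rfl | ht
  · rw [Set.Icc_self, Set.mem_singleton_iff] at hr
    rw [hr, sub_self, inner_zero_right]
  have hder : ∀ q ∈ Set.Icc 0 t, HasDerivWithinAt (fun s => inner ℝ w (y s)) 0 (Set.Icc 0 t) q := by
    intro q hq
    have hinner := (innerSL ℝ w).hasFDerivAt.comp_hasDerivWithinAt q (hy q hq)
    rwa [innerSL_apply_apply, V.inner_left_of_mem_orthogonal (hV q hq) hw] at hinner
  have hconst := constant_of_derivWithin_zero (fun q hq => (hder q hq).differentiableWithinAt)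
    (fun q hq => (hder q (Set.Ico_subset_Icc_self hq)).derivWithin
      (uniqueDiffOn_Icc ht q (Set.Ico_subset_Icc_self hq))) r hr
  rw [inner_sub_right, hconst, sub_self]

section Trajectory

variable {conn : Connectivity d N Nv} {I : Config d Nv → ℝ} {V : Fin Nv → Submodule ℝ (Pt d)}
  {P : Fin Nv → ℝ → ℝ} {τ : ℝ} {T : EReal} {x : ℝ → Config d Nv} {t : ℝ}

lemma IsTrajectory.exists_velocity (hx : IsTrajectory conn I V P τ T x) (htT : (t : EReal) < T)
    (hnd : ∀ r ∈ Set.Icc 0 t, Nondegenerate conn (x r)) :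
    ∃ (x' : ℝ → Config d Nv) (L : ℝ → Config d Nv →L[ℝ] ℝ), ∀ r ∈ Set.Icc 0 t,
      HasFDerivWithinAt I (L r) {y | ∀ i, y i - x r i ∈ V i} (x r) ∧
      ∀ i, x' r i ∈ V i ∧ HasDerivWithinAt (fun s => x s i) (x' r i) (Set.Icc 0 t) r ∧
        inner ℝ (x' r i) (x' r i) = -(P i r / τ) * L r (Pi.single i (x' r i)) := by
  have hequation := fun r (hr : r ∈ Set.Icc 0 t) =>
    hx.equation r hr.1 ((EReal.coe_le_coe_iff.2 hr.2).trans_lt htT) (hnd r hr)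
  choose! L hL x' hx'V hx' hinner using hequation
  exact ⟨x', L, fun r hr => ⟨hL r hr, fun i => ⟨hx'V r hr i,
    (hx' r hr i).mono Set.Icc_subset_Ici_self, hinner r hr i _ (hx'V r hr i)⟩⟩⟩

lemma IsTrajectory.energy_le (hx : IsTrajectory conn I V P τ T x) (hτ : 0 < τ)
    (hP : ∀ i t, 0 < P i t) (ht : 0 ≤ t) (htT : (t : EReal) < T)
    (hnd : ∀ r ∈ Set.Icc 0 t, Nondegenerate conn (x r)) : I (x t) ≤ I (x 0) := by
  obtain ⟨x', L, h⟩ := hx.exists_velocity htT hnd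
  have hmem : ∀ r ∈ Set.Icc 0 t, ∀ i, x r i - x 0 i ∈ V i := fun r hr i =>
    sub_mem_of_hasDerivWithinAt_mem (fun q hq => ((h q hq).2 i).2.1)
      (fun q hq => ((h q hq).2 i).1) hr
  have hder : ∀ r ∈ Set.Icc 0 t,
      HasDerivWithinAt (fun s => I (x s)) (L r (x' r)) (Set.Icc 0 t) r := by
    intro r hr
    refine (h r hr).1.comp_hasDerivWithinAt r
      (hasDerivWithinAt_pi.2 fun i => ((h r hr).2 i).2.1) fun q hq i => ?_
    rw [← sub_sub_sub_cancel_right (x q i) (x r i) (x 0 i)]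
    exact (V i).sub_mem (hmem q hq i) (hmem r hr i)
  have hnonpos : ∀ r ∈ Set.Icc 0 t, L r (x' r) ≤ 0 := by
    intro r hr
    rw [← Finset.univ_sum_single (x' r), map_sum]
    refine Finset.sum_nonpos fun i _ => ?_
    have hspeed : 0 ≤ -(P i r / τ) * L r (Pi.single i (x' r i)) :=
      ((h r hr).2 i).2.2 ▸ real_inner_self_nonneg
    have hrate : 0 < P i r / τ := div_pos (hP i r) hτ
    rw [neg_mul, ← mul_neg] at hspeed
    exact neg_nonneg.1 (nonneg_of_mul_nonneg_right hspeed hrate)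
  have hanti : AntitoneOn (fun s => I (x s)) (Set.Icc 0 t) :=
    antitoneOn_of_hasDerivWithinAt_nonpos (convex_Icc 0 t)
      (fun r hr => (hder r hr).continuousWithinAt)
      (fun r hr => (hder r (interior_subset hr)).mono interior_subset)
      (fun r hr => hnonpos r (interior_subset hr))
  exact hanti ⟨le_rfl, ht⟩ ⟨ht, le_rfl⟩ ht

lemma IsTrajectory.isNonsingularMesh (hx : IsTrajectory conn I V P τ T x) (hd : d ≠ 0)
    {Ω : Set (Pt d)} (hΩ : IsOpen Ω) (h₀ : IsNonsingularMesh Ω conn (x 0))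
    (hV : ∀ i, V i ≤ slideSpace conn (x 0) i) (ht : 0 ≤ t) (htT : (t : EReal) < T)
    (hnd : ∀ r ∈ Set.Icc 0 t, Nondegenerate conn (x r)) : IsNonsingularMesh Ω conn (x t) := by
  obtain ⟨x', L, h⟩ := hx.exists_velocity htT hnd
  have hslide : ∀ r ∈ Set.Icc 0 t, ∀ i, x r i - x 0 i ∈ slideSpace conn (x 0) i := fun r hr i =>
    hV i (sub_mem_of_hasDerivWithinAt_mem (fun q hq => ((h q hq).2 i).2.1)
      (fun q hq => ((h q hq).2 i).1) hr)
  have hmotion := isBoundaryPreservingMotion_of_sub_mem_slideSpace h₀.nondegenerate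
    (fun i r hr => ((h r hr).2 i).2.1.differentiableWithinAt) hslide
  exact h₀.of_isBoundaryPreservingMotion hd hΩ ht hmotion hnd

end Trajectory

/-! ### Quadratic forms with spectral bounds -/

section SpectralBounds

variable {n : Type*} [Fintype n]

lemma dotProduct_mulVec_eq_sum (A : Matrix n n ℝ) (u : n → ℝ) :
    u ⬝ᵥ A *ᵥ u = ∑ i, ∑ j, u i * A i j * u j := by
  simp only [dotProduct, Matrix.mulVec, Finset.mul_sum, mul_assoc]

/-- The two-sided bound `mlo I ≤ A ≤ mhi I` for a symmetric matrix `A`, in terms of the quadratic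
forms, which makes it visibly stable under averaging. -/
structure IsSpectrallyBounded (mlo mhi : ℝ) (A : Matrix n n ℝ) : Prop where
  isHermitian : A.IsHermitian
  lower : ∀ u : n → ℝ, mlo * (u ⬝ᵥ u) ≤ u ⬝ᵥ A *ᵥ u
  upper : ∀ u : n → ℝ, u ⬝ᵥ A *ᵥ u ≤ mhi * (u ⬝ᵥ u)

variable {mlo mhi : ℝ} {A : Matrix n n ℝ}

lemma isSpectrallyBounded_of_posSemidef [DecidableEq n]
    (hlo : (A - mlo • (1 : Matrix n n ℝ)).PosSemidef)
    (hhi : (mhi • (1 : Matrix n n ℝ) - A).PosSemidef) : IsSpectrallyBounded mlo mhi A where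
  isHermitian := by
    have hone : (mlo • (1 : Matrix n n ℝ)).IsHermitian := by simp [Matrix.IsHermitian]
    simpa only [sub_add_cancel] using hlo.isHermitian.add hone
  lower u := by
    have := hlo.dotProduct_mulVec_nonneg u
    simp only [star_trivial, Matrix.sub_mulVec, Matrix.smul_mulVec, Matrix.one_mulVec,
      dotProduct_sub, dotProduct_smul, smul_eq_mul] at this
    linarith
  upper u := by
    have := hhi.dotProduct_mulVec_nonneg u
    simp only [star_trivial, Matrix.sub_mulVec, Matrix.smul_mulVec, Matrix.one_mulVec,
      dotProduct_sub, dotProduct_smul, smul_eq_mul] at this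
    linarith

namespace IsSpectrallyBounded

lemma dotProduct_mulVec_nonneg (hA : IsSpectrallyBounded mlo mhi A) (hmlo : 0 ≤ mlo)
    (u : n → ℝ) : 0 ≤ u ⬝ᵥ A *ᵥ u :=
  (mul_nonneg hmlo (dotProduct_self_star_nonneg u)).trans (hA.lower u)

lemma posSemidef (hA : IsSpectrallyBounded mlo mhi A) (hmlo : 0 ≤ mlo) : A.PosSemidef :=
  .of_dotProduct_mulVec_nonneg hA.isHermitian (hA.dotProduct_mulVec_nonneg hmlo)

lemma abs_apply_le (hA : IsSpectrallyBounded mlo mhi A) (hmlo : 0 ≤ mlo) (i j : n) :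
    |A i j| ≤ mhi := by
  classical
  have hsymm : A j i = A i j := by simpa only [star_trivial] using hA.isHermitian.apply i j
  have hdiag : ∀ l, A l l ≤ mhi := fun l => by simpa using hA.upper (Pi.single l 1)
  have hpolar : ∀ s : ℝ, 0 ≤ A i i + 2 * s * A i j + s ^ 2 * A j j := by
    intro s
    have h := hA.dotProduct_mulVec_nonneg hmlo (Pi.single i 1 + s • Pi.single j 1)
    simp only [Matrix.mulVec_add, Matrix.mulVec_smul, add_dotProduct, dotProduct_add,
      smul_dotProduct, dotProduct_smul, Matrix.mulVec_single_one, single_one_dotProduct,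
      Matrix.col_apply, hsymm, smul_eq_mul] at h
    linarith
  have hi := hdiag i
  have hj := hdiag j
  have hadd := hpolar 1
  have hsub := hpolar (-1)
  exact abs_le.2 ⟨by linarith, by linarith⟩

lemma eigenvalues_mem_Icc [DecidableEq n] (hA : IsSpectrallyBounded mlo mhi A) (i : n) :
    hA.isHermitian.eigenvalues i ∈ Set.Icc mlo mhi := by
  set e := hA.isHermitian.eigenvectorBasis i with he
  have hunit : e.ofLp ⬝ᵥ e.ofLp = 1 := by
    have h : inner ℝ e e = (1 : ℝ) := by
      rw [real_inner_self_eq_norm_sq, he, OrthonormalBasis.norm_eq_one, one_pow]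
    rwa [EuclideanSpace.inner_eq_star_dotProduct, star_trivial] at h
  have heig : hA.isHermitian.eigenvalues i = e.ofLp ⬝ᵥ A *ᵥ e.ofLp := by
    rw [hA.isHermitian.eigenvalues_eq i]
    rfl
  have hlo := hA.lower e.ofLp
  have hhi := hA.upper e.ofLp
  rw [hunit, mul_one] at hlo hhi
  exact heig ▸ ⟨hlo, hhi⟩

lemma pow_le_det [DecidableEq n] (hA : IsSpectrallyBounded mlo mhi A) (hmlo : 0 ≤ mlo) :
    mlo ^ Fintype.card n ≤ A.det := by
  rw [hA.isHermitian.det_eq_prod_eigenvalues, ← Finset.card_univ, ← Finset.prod_const]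
  exact Finset.prod_le_prod (fun _ _ => hmlo) fun i _ => (hA.eigenvalues_mem_Icc i).1

lemma det_le_pow [DecidableEq n] (hA : IsSpectrallyBounded mlo mhi A) (hmlo : 0 ≤ mlo) :
    A.det ≤ mhi ^ Fintype.card n := by
  rw [hA.isHermitian.det_eq_prod_eigenvalues, ← Finset.card_univ, ← Finset.prod_const]
  exact Finset.prod_le_prod (fun i _ => hmlo.trans (hA.eigenvalues_mem_Icc i).1)
    fun i _ => (hA.eigenvalues_mem_Icc i).2

lemma posDef (hA : IsSpectrallyBounded mlo mhi A) (hmlo : 0 < mlo) : A.PosDef := by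
  classical
  exact (hA.posSemidef hmlo.le).posDef_iff_det_ne_zero.2
    ((pow_pos hmlo _).trans_le (hA.pow_le_det hmlo.le)).ne'

end IsSpectrallyBounded

section Integral

variable {α : Type*} [MeasurableSpace α] {μ : Measure α} {M : α → Matrix n n ℝ}

lemma integrable_dotProduct_mulVec (hM : ∀ i j, Integrable (fun a => M a i j) μ) (u : n → ℝ) :
    Integrable (fun a => u ⬝ᵥ M a *ᵥ u) μ := by
  simp only [dotProduct_mulVec_eq_sum]
  exact integrable_finsetSum _ fun i _ => integrable_finsetSum _ fun j _ =>
    ((hM i j).const_mul _).mul_const _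

lemma dotProduct_integral_mulVec (hM : ∀ i j, Integrable (fun a => M a i j) μ) (u : n → ℝ) :
    u ⬝ᵥ (Matrix.of fun i j => ∫ a, M a i j ∂μ) *ᵥ u = ∫ a, u ⬝ᵥ M a *ᵥ u ∂μ := by
  have hintegrable : ∀ i j, Integrable (fun a => u i * M a i j * u j) μ := fun i j =>
    ((hM i j).const_mul _).mul_const _
  simp only [dotProduct_mulVec_eq_sum]
  rw [integral_finsetSum _ fun i _ => integrable_finsetSum _ fun j _ => hintegrable i j]
  refine Finset.sum_congr rfl fun i _ => ?_
  rw [integral_finsetSum _ fun j _ => hintegrable i j]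
  refine Finset.sum_congr rfl fun j _ => ?_
  rw [integral_mul_const, integral_const_mul, Matrix.of_apply]

lemma IsSpectrallyBounded.integral [IsProbabilityMeasure μ] (hmlo : 0 ≤ mlo)
    (hmeas : ∀ i j, AEMeasurable (fun a => M a i j) μ)
    (hM : ∀ᵐ a ∂μ, IsSpectrallyBounded mlo mhi (M a)) :
    IsSpectrallyBounded mlo mhi (Matrix.of fun i j => ∫ a, M a i j ∂μ) := by
  have hintegrable : ∀ i j, Integrable (fun a => M a i j) μ := fun i j =>
    Integrable.of_bound (hmeas i j).aestronglyMeasurable mhi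
      (hM.mono fun a ha => ha.abs_apply_le hmlo i j)
  have hconst : ∀ c : ℝ, c = ∫ _, c ∂μ := fun c => by simp
  refine ⟨?_, fun u => ?_, fun u => ?_⟩
  · ext i j
    simp only [Matrix.conjTranspose_apply, star_trivial, Matrix.of_apply]
    refine integral_congr_ae (hM.mono fun a ha => ?_)
    simpa only [star_trivial] using ha.isHermitian.apply i j
  · rw [dotProduct_integral_mulVec hintegrable, hconst (mlo * _)]
    exact integral_mono_ae (integrable_const _) (integrable_dotProduct_mulVec hintegrable u)
      (hM.mono fun a ha => ha.lower u)
  · rw [dotProduct_integral_mulVec hintegrable, hconst (mhi * _)]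
    exact integral_mono_ae (integrable_dotProduct_mulVec hintegrable u) (integrable_const _)
      (hM.mono fun a ha => ha.upper u)

end Integral

end SpectralBounds

lemma IsPolyhedralDomain.volume_frontier {Ω : Set (Pt d)} (hΩ : IsPolyhedralDomain Ω) :
    volume (frontier Ω) = 0 := by
  obtain ⟨H, hH, hsub⟩ := hΩ.flat_boundary
  refine measure_mono_null hsub ((measure_biUnion_null_iff H.countable_toSet).2 ?_)
  exact fun s hs => Measure.addHaar_affineSubspace volume s (hH s hs)

lemma IsMetricTensor.isSpectrallyBounded_avgMetric {Ω : Set (Pt d)} {mlo mhi : ℝ}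
    {M : Pt d → Matrix (Fin d) (Fin d) ℝ} (hM : IsMetricTensor Ω mlo mhi M) (hmlo : 0 ≤ mlo)
    (hΩ : IsOpen Ω) (hfr : volume (frontier Ω) = 0) {v : Fin (d + 1) → Pt d}
    (hv : AffineIndependent ℝ v) (hsub : simplex v ⊆ closure Ω) :
    IsSpectrallyBounded mlo mhi (avgMetric M v) := by
  have hle : volume.restrict (simplex v) ≤ volume.restrict Ω := by
    rw [← Measure.restrict_congr_set (closure_ae_eq_of_null_frontier hfr)]
    exact Measure.restrict_mono_set volume hsub
  obtain ⟨hpos, hfin⟩ := ENNReal.toReal_pos_iff.1 (simplexVolume_pos_iff.2 hv)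
  have : IsProbabilityMeasure ((volume (simplex v))⁻¹ • volume.restrict (simplex v)) :=
    ProbabilityTheory.cond_isProbabilityMeasure_of_finite hpos.ne' hfin.ne
  simp only [avgMetric, setAverage_eq']
  refine .integral hmlo (fun i j => ((hM.measurable i j).mono_measure hle).smul_measure _) ?_
  refine Measure.ae_smul_measure (ae_mono hle ?_) _
  exact ae_restrict_of_forall_mem hΩ.measurableSet fun y hy =>
    isSpectrallyBounded_of_posSemidef (hM.lower y hy) (hM.upper y hy)

/-! ### Traces, determinants and the Frobenius norm -/

section Trace

variable {n : Type*} [Fintype n]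

lemma det_le_pow_of_trace_le [DecidableEq n] [Nonempty n] {G : Matrix n n ℝ} (hG : G.PosSemidef)
    {Y : ℝ} (h : G.trace ≤ Fintype.card n * Y) : G.det ≤ Y ^ Fintype.card n := by
  set eig := hG.isHermitian.eigenvalues
  have hnonneg : ∀ i, 0 ≤ eig i := hG.eigenvalues_nonneg
  have hcard : (0 : ℝ) < Fintype.card n := by exact_mod_cast Fintype.card_pos
  have htrace : G.trace = ∑ i, eig i := hG.isHermitian.trace_eq_sum_eigenvalues
  have hdet : G.det = ∏ i, eig i := hG.isHermitian.det_eq_prod_eigenvalues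
  have hamgm := Real.geom_mean_le_arith_mean Finset.univ (fun _ => 1) eig (fun _ _ => zero_le_one)
    (by simpa using hcard) fun i _ => hnonneg i
  simp only [Real.rpow_one, Finset.sum_const, Finset.card_univ, nsmul_eq_mul, mul_one,
    one_mul, ← htrace, ← hdet] at hamgm
  have hroot : G.det ^ (Fintype.card n : ℝ)⁻¹ ≤ Y := hamgm.trans ((div_le_iff₀' hcard).2 h)
  calc G.det = (G.det ^ (Fintype.card n : ℝ)⁻¹) ^ Fintype.card n :=
        (Real.rpow_inv_natCast_pow hG.det_nonneg Fintype.card_ne_zero).symm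
    _ ≤ Y ^ Fintype.card n := pow_le_pow_left₀ (Real.rpow_nonneg hG.det_nonneg _) hroot _

lemma card_mul_sq_le_of_sum_eq_zero {ι : Type*} [Fintype ι] {a : ι → ℝ} (ha : ∑ i, a i = 0)
    (j : ι) : Fintype.card ι * a j ^ 2 ≤ (Fintype.card ι - 1) * ∑ i, a i ^ 2 := by
  classical
  rw [← Finset.add_sum_erase _ _ (Finset.mem_univ j)] at ha
  have hcauchy := sq_sum_le_card_mul_sum_sq (s := Finset.univ.erase j) (f := a)
  rw [Finset.cast_card_erase_of_mem (Finset.mem_univ j), Finset.card_univ,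
    ← neg_eq_of_add_eq_zero_right ha, neg_sq] at hcauchy
  rw [← Finset.add_sum_erase _ _ (Finset.mem_univ j)]
  linarith

lemma card_mul_dotProduct_mulVec_le {ι : Type*} [Fintype ι] {B : Matrix n n ℝ}
    (hB : B.PosSemidef) {g : ι → n → ℝ} (hg : ∑ l, g l = 0) (j : ι) :
    Fintype.card ι * (g j ⬝ᵥ B *ᵥ g j) ≤ (Fintype.card ι - 1) * ∑ l, g l ⬝ᵥ B *ᵥ g l := by
  obtain ⟨C, rfl⟩ : ∃ C : Matrix n n ℝ, B = Cᴴ * C := by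
    classical
    open scoped MatrixOrder in
    exact CStarAlgebra.nonneg_iff_eq_star_mul_self.1 hB.nonneg
  have hquad : ∀ u, u ⬝ᵥ (Cᴴ * C) *ᵥ u = ∑ i, (C *ᵥ u) i ^ 2 := fun u => by
    rw [← Matrix.mulVec_mulVec, Matrix.dotProduct_mulVec, Matrix.vecMul_conjTranspose,
      star_trivial, star_trivial]
    exact Finset.sum_congr rfl fun i _ => (sq _).symm
  simp only [hquad]
  rw [Finset.sum_comm, Finset.mul_sum, Finset.mul_sum]
  refine Finset.sum_le_sum fun i _ =>
    card_mul_sq_le_of_sum_eq_zero (a := fun l => (C *ᵥ g l) i) ?_ j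
  rw [← Finset.sum_apply, ← Matrix.mulVec_sum, hg, Matrix.mulVec_zero, Pi.zero_apply]

lemma inv_le_dotProduct_mulVec [DecidableEq n] {A : Matrix n n ℝ} (hA : A.PosDef) {g u : n → ℝ}
    (hgu : g ⬝ᵥ u = 1) {Y : ℝ} (hY : 0 < Y) (hg : g ⬝ᵥ A⁻¹ *ᵥ g ≤ Y) : Y⁻¹ ≤ u ⬝ᵥ A *ᵥ u := by
  set w := A⁻¹ *ᵥ g
  have hAw : A *ᵥ w = g := by
    rw [Matrix.mulVec_mulVec, Matrix.mul_nonsing_inv _ (isUnit_iff_ne_zero.2 hA.det_pos.ne'),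
      Matrix.one_mulVec]
  have hsymm : w ⬝ᵥ A *ᵥ u = g ⬝ᵥ u := by
    have hT : Aᵀ = A := by simpa using hA.isHermitian.eq
    rw [Matrix.dotProduct_mulVec, ← Matrix.mulVec_transpose, hT, hAw]
  -- the Cauchy-Schwarz inequality for `A`, as nonnegativity at `u - Y⁻¹ • w`
  have hnonneg := hA.posSemidef.dotProduct_mulVec_nonneg (u - Y⁻¹ • w)
  simp only [star_trivial, Matrix.mulVec_sub, Matrix.mulVec_smul, hAw, sub_dotProduct,
    dotProduct_sub, smul_dotProduct, dotProduct_smul, smul_eq_mul, hsymm] at hnonneg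
  rw [dotProduct_comm u g, hgu, dotProduct_comm w g] at hnonneg
  have hcancel : Y⁻¹ * (Y⁻¹ * g ⬝ᵥ w) ≤ Y⁻¹ := by
    calc Y⁻¹ * (Y⁻¹ * g ⬝ᵥ w) ≤ Y⁻¹ * (Y⁻¹ * Y) := by gcongr
      _ = Y⁻¹ := by rw [inv_mul_cancel₀ hY.ne', mul_one]
  linarith

end Trace

lemma frobNorm_nonneg (S : Matrix (Fin d) (Fin d) ℝ) : 0 ≤ frobNorm S :=
  Real.sqrt_nonneg _

open scoped Matrix.Norms.Frobenius in
lemma frobNorm_eq_norm (S : Matrix (Fin d) (Fin d) ℝ) : frobNorm S = ‖S‖ := by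
  simp [frobNorm, Matrix.frobenius_norm_def, Real.sqrt_eq_rpow]

open scoped Matrix.Norms.Frobenius in
lemma frobNorm_le_frobNorm_sub_add (S R : Matrix (Fin d) (Fin d) ℝ) :
    frobNorm S ≤ frobNorm (S - R) + frobNorm R := by
  simpa only [frobNorm_eq_norm] using norm_le_norm_sub_add S R

lemma frobNorm_smul_one (γ : ℝ) :
    frobNorm (γ • (1 : Matrix (Fin d) (Fin d) ℝ)) = √(γ ^ 2 * d) := by
  simp [frobNorm, Matrix.one_apply, mul_comm]

lemma trace_le_sqrt_mul_frobNorm (S : Matrix (Fin d) (Fin d) ℝ) :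
    S.trace ≤ √d * frobNorm S := by
  have hdiag : ∑ i, S i i ^ 2 ≤ ∑ i, ∑ j, S i j ^ 2 := Finset.sum_le_sum fun i _ =>
    Finset.single_le_sum (f := fun j => S i j ^ 2) (fun j _ => sq_nonneg _) (Finset.mem_univ i)
  have hcauchy := sq_sum_le_card_mul_sum_sq (s := Finset.univ) (f := fun i => S i i)
  rw [Finset.card_fin] at hcauchy
  rw [frobNorm, ← Real.sqrt_mul (Nat.cast_nonneg d)]
  exact Real.le_sqrt_of_sq_le (hcauchy.trans (by gcongr))

/-! ### The reference element -/

lemma transpose_edgeMatrix_mul_edgeMatrix_of_equilateral {ξ : Fin (d + 1) → Pt d} {ℓ : ℝ}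
    (h : ∀ i j, i ≠ j → dist (ξ i) (ξ j) = ℓ) :
    (edgeMatrix ξ)ᵀ * edgeMatrix ξ = (ℓ ^ 2 / 2) • (1 + Matrix.of fun _ _ => 1) := by
  ext i j
  have hinner : ((edgeMatrix ξ)ᵀ * edgeMatrix ξ) i j =
      inner ℝ (ξ i.succ - ξ 0) (ξ j.succ - ξ 0) := by
    rw [EuclideanSpace.inner_eq_star_dotProduct, dotProduct_comm]
    rfl
  have hnorm : ∀ l : Fin d, ‖ξ l.succ - ξ 0‖ = ℓ := fun l => by
    rw [← dist_eq_norm]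
    exact h _ _ (Fin.succ_ne_zero l)
  rw [hinner]
  by_cases hij : i = j
  · subst hij
    simp only [real_inner_self_eq_norm_sq, hnorm, Matrix.smul_apply, Matrix.add_apply,
      Matrix.one_apply_eq, Matrix.of_apply, smul_eq_mul]
    ring
  · have hside : ‖ξ i.succ - ξ j.succ‖ = ℓ := by
      rw [← dist_eq_norm]
      exact h _ _ ((Fin.succ_injective d).ne hij)
    have hcosine := norm_sub_sq_real (ξ i.succ - ξ 0) (ξ j.succ - ξ 0)
    rw [sub_sub_sub_cancel_right, hnorm, hnorm, hside] at hcosine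
    simp only [Matrix.smul_apply, Matrix.add_apply, Matrix.one_apply_ne hij, Matrix.of_apply,
      smul_eq_mul]
    linarith

lemma det_one_add_of_one (d : ℕ) : (1 + Matrix.of fun _ _ : Fin d => (1 : ℝ)).det = d + 1 := by
  have hrankOne : (Matrix.of fun _ _ : Fin d => (1 : ℝ)) =
      Matrix.replicateCol Unit (fun _ => (1 : ℝ)) *
        Matrix.replicateRow Unit (fun _ => (1 : ℝ)) := by
    ext i j
    simp [Matrix.mul_apply]
  rw [hrankOne, Matrix.det_one_add_replicateCol_mul_replicateRow]
  simp [dotProduct, add_comm]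

/-- Half the squared edge length of an equilateral `d`-simplex of volume one. -/
def referenceScale (d : ℕ) : ℝ := ((d.factorial : ℝ) ^ 2 / (d + 1)) ^ (d : ℝ)⁻¹

lemma referenceScale_pos (d : ℕ) : 0 < referenceScale d := by
  rw [referenceScale]
  positivity

namespace IsReferenceElement

variable {ξ : Fin (d + 1) → Pt d}

lemma abs_det_edgeMatrix (hξ : IsReferenceElement ξ) : |(edgeMatrix ξ).det| = d.factorial := by
  have h := hξ.unitary
  rwa [simplexVolume_eq, det_homMatrix, div_eq_one_iff_eq (by positivity)] at h

lemma det_edgeMatrix_ne_zero (hξ : IsReferenceElement ξ) : (edgeMatrix ξ).det ≠ 0 := by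
  rw [← abs_pos, hξ.abs_det_edgeMatrix]
  positivity

lemma transpose_edgeMatrix_mul_edgeMatrix (hξ : IsReferenceElement ξ) (hd : d ≠ 0) :
    (edgeMatrix ξ)ᵀ * edgeMatrix ξ = referenceScale d • (1 + Matrix.of fun _ _ => 1) := by
  obtain ⟨ℓ, hℓ⟩ := hξ.equilateral
  have hgram := transpose_edgeMatrix_mul_edgeMatrix_of_equilateral hℓ
  have hdet := congrArg Matrix.det hgram
  rw [Matrix.det_mul, Matrix.det_transpose, Matrix.det_smul, det_one_add_of_one, Fintype.card_fin,
    ← sq, ← sq_abs, hξ.abs_det_edgeMatrix] at hdet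
  have hscale : ℓ ^ 2 / 2 = referenceScale d := by
    rw [referenceScale, hdet, mul_div_cancel_right₀ _ (by positivity),
      Real.pow_rpow_inv_natCast (by positivity) hd]
  rw [hgram, hscale]

end IsReferenceElement

/-! ### Altitudes, volumes and the gradients of the barycentric coordinates -/

/-- The gradient of the `j`-th barycentric coordinate of the simplex with vertices `v`. -/
def baryGrad (v : Fin (d + 1) → Pt d) (j : Fin (d + 1)) : Fin d → ℝ :=
  Fin.tail (facetCovector v j)

lemma dotProduct_baryGrad (v : Fin (d + 1) → Pt d) (j : Fin (d + 1)) (u : Pt d) :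
    u.ofLp ⬝ᵥ baryGrad v j = homDir u ⬝ᵥ facetCovector v j := by
  simp [dotProduct, Fin.sum_univ_succ, baryGrad, Fin.tail]

/-- The inner product of the gradients of two barycentric coordinates in the metric dual to `A`. -/
def gradGram (A : Matrix (Fin d) (Fin d) ℝ) (v : Fin (d + 1) → Pt d) :
    Matrix (Fin (d + 1)) (Fin (d + 1)) ℝ :=
  Matrix.of fun j l => baryGrad v j ⬝ᵥ A⁻¹ *ᵥ baryGrad v l

/-- The matrix `(F_K')⁻¹ A⁻¹ (F_K')⁻ᵀ`, whose deviation from a multiple of the identity is measured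
by the functional. -/
def shapeMatrix (ξ v : Fin (d + 1) → Pt d) (A : Matrix (Fin d) (Fin d) ℝ) :
    Matrix (Fin d) (Fin d) ℝ :=
  (jacobian ξ v)⁻¹ * A⁻¹ * ((jacobian ξ v)⁻¹)ᵀ

section Nondegenerate

variable {v : Fin (d + 1) → Pt d}

lemma sum_baryGrad (hv : AffineIndependent ℝ v) : ∑ j, baryGrad v j = 0 := by
  have hone : homMatrix v *ᵥ Pi.single 0 1 = 1 := by
    ext j
    simp [homMatrix_apply]
  have hinv : (homMatrix v)⁻¹ *ᵥ 1 = Pi.single 0 1 := by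
    rw [← hone, Matrix.mulVec_mulVec, Matrix.nonsing_inv_mul _ (isUnit_homMatrix hv),
      Matrix.one_mulVec]
  ext i
  have hi := congrFun hinv i.succ
  rw [Pi.single_eq_of_ne (Fin.succ_ne_zero i)] at hi
  simpa [baryGrad, Fin.tail, facetCovector, Matrix.mulVec, dotProduct] using hi

lemma vertex_sub_vertex_dotProduct_baryGrad (hv : AffineIndependent ℝ v) (i l j : Fin (d + 1)) :
    (v i - v l).ofLp ⬝ᵥ baryGrad v j =
      (1 : Matrix (Fin (d + 1)) (Fin (d + 1)) ℝ) i j - (1 : Matrix _ _ ℝ) l j := by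
  rw [dotProduct_baryGrad, ← homPoint_sub_homPoint, sub_dotProduct,
    homPoint_dotProduct_facetCovector hv, homPoint_dotProduct_facetCovector hv]

lemma baryGrad_dotProduct_sub_eq_one (hv : AffineIndependent ℝ v) {j : Fin (d + 1)} {z : Pt d}
    (hz : z ∈ affineSpan ℝ (v '' {l | l ≠ j})) : baryGrad v j ⬝ᵥ (v j - z).ofLp = 1 := by
  obtain ⟨_, l, hl, rfl⟩ : (v '' {l | l ≠ j}).Nonempty := (affineSpan_nonempty ℝ).1 ⟨z, hz⟩
  have hfacet : (z - v l).ofLp ⬝ᵥ baryGrad v j = 0 := by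
    rw [dotProduct_baryGrad]
    refine homDir_dotProduct_eq_zero_of_mem_vectorSpan (s := v '' {l | l ≠ j}) ?_ ?_
    · rintro _ ⟨i, hi, rfl⟩
      rw [homPoint_dotProduct_facetCovector hv, Matrix.one_apply_ne hi]
    · rw [← direction_affineSpan]
      exact AffineSubspace.vsub_mem_direction hz (mem_affineSpan ℝ ⟨l, hl, rfl⟩)
  rw [dotProduct_comm, ← sub_sub_sub_cancel_right _ _ (v l), WithLp.ofLp_sub 2, sub_dotProduct,
    hfacet, vertex_sub_vertex_dotProduct_baryGrad hv, Matrix.one_apply_eq, Matrix.one_apply_ne hl,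
    sub_zero, sub_zero]

lemma inv_edgeMatrix (hv : AffineIndependent ℝ v) :
    (edgeMatrix v)⁻¹ = Matrix.of fun i => baryGrad v i.succ := by
  refine Matrix.inv_eq_left_inv ?_
  ext i j
  have h := vertex_sub_vertex_dotProduct_baryGrad hv j.succ 0 i.succ
  rw [Matrix.one_apply_ne (Fin.succ_ne_zero i).symm, sub_zero, dotProduct_comm] at h
  simpa [Matrix.mul_apply, dotProduct, edgeMatrix, Matrix.one_apply, eq_comm] using h

variable {A : Matrix (Fin d) (Fin d) ℝ}

lemma inv_edgeMatrix_mul_inv_mul_transpose (hv : AffineIndependent ℝ v) :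
    (edgeMatrix v)⁻¹ * A⁻¹ * ((edgeMatrix v)⁻¹)ᵀ =
      (gradGram A v).submatrix Fin.succ Fin.succ := by
  ext i j
  rw [inv_edgeMatrix hv, Matrix.mul_assoc]
  rfl

lemma gradGram_zero_zero (hv : AffineIndependent ℝ v) :
    gradGram A v 0 0 = ∑ i : Fin d, ∑ j : Fin d, gradGram A v i.succ j.succ := by
  have hzero : baryGrad v 0 = -∑ i : Fin d, baryGrad v i.succ := by
    rw [eq_neg_iff_add_eq_zero, ← Fin.sum_univ_succ, sum_baryGrad hv]
  simp only [gradGram, Matrix.of_apply]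
  rw [hzero, Matrix.mulVec_neg, neg_dotProduct_neg, sum_dotProduct]
  simp only [Matrix.mulVec_sum, dotProduct_sum]

lemma gradGram_self_nonneg (hA : A.PosDef) (v : Fin (d + 1) → Pt d) (j : Fin (d + 1)) :
    0 ≤ gradGram A v j j :=
  hA.inv.posSemidef.dotProduct_mulVec_nonneg _

lemma posSemidef_submatrix_gradGram (hA : A.PosDef) (hv : AffineIndependent ℝ v) :
    ((gradGram A v).submatrix Fin.succ Fin.succ).PosSemidef := by
  rw [← inv_edgeMatrix_mul_inv_mul_transpose hv, ← Matrix.conjTranspose_eq_transpose_of_trivial]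
  exact hA.inv.posSemidef.mul_mul_conjTranspose_same _

lemma trace_shapeMatrix (hd : d ≠ 0) {ξ : Fin (d + 1) → Pt d} (hξ : IsReferenceElement ξ)
    (hv : AffineIndependent ℝ v) :
    (shapeMatrix ξ v A).trace = referenceScale d * (gradGram A v).trace := by
  set G := (gradGram A v).submatrix Fin.succ Fin.succ with hG
  have hinv : (jacobian ξ v)⁻¹ = edgeMatrix ξ * (edgeMatrix v)⁻¹ := by
    rw [jacobian, Matrix.mul_inv_rev, Matrix.nonsing_inv_nonsing_inv _
      (isUnit_iff_ne_zero.2 hξ.det_edgeMatrix_ne_zero)]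
  have hshape : shapeMatrix ξ v A = edgeMatrix ξ * (G * (edgeMatrix ξ)ᵀ) := by
    rw [hG, ← inv_edgeMatrix_mul_inv_mul_transpose hv, shapeMatrix, hinv, Matrix.transpose_mul]
    simp only [Matrix.mul_assoc]
  have hsum : (G * Matrix.of fun _ _ => 1).trace = gradGram A v 0 0 := by
    rw [gradGram_zero_zero hv]
    simp [hG, Matrix.trace, Matrix.mul_apply]
  rw [hshape, Matrix.trace_mul_comm, Matrix.mul_assoc,
    hξ.transpose_edgeMatrix_mul_edgeMatrix hd, Matrix.mul_smul, Matrix.trace_smul, smul_eq_mul,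
    Matrix.mul_add, Matrix.mul_one, Matrix.trace_add, hsum]
  simp only [Matrix.trace, Fin.sum_univ_succ (n := d), Matrix.diag_apply, hG,
    Matrix.submatrix_apply, add_comm]

lemma mul_gradGram_self_le_frobNorm_shapeMatrix (hd : d ≠ 0) {ξ : Fin (d + 1) → Pt d}
    (hξ : IsReferenceElement ξ) (hA : A.PosDef) (hv : AffineIndependent ℝ v) (j : Fin (d + 1)) :
    (d + 1) / d * referenceScale d / √d * gradGram A v j j ≤ frobNorm (shapeMatrix ξ v A) := by
  have : (0 : ℝ) < d := by exact_mod_cast Nat.pos_of_ne_zero hd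
  have hscale := referenceScale_pos d
  have htrace := trace_le_sqrt_mul_frobNorm (shapeMatrix ξ v A)
  rw [trace_shapeMatrix hd hξ hv] at htrace
  have hbalance : (d + 1) * gradGram A v j j ≤ d * (gradGram A v).trace := by
    simpa [gradGram, Matrix.trace] using
      card_mul_dotProduct_mulVec_le hA.inv.posSemidef (sum_baryGrad hv) j
  calc (d + 1) / d * referenceScale d / √d * gradGram A v j j
      = referenceScale d / (d * √d) * ((d + 1) * gradGram A v j j) := by field
    _ ≤ referenceScale d / (d * √d) * (d * (gradGram A v).trace) := by gcongr
    _ = referenceScale d * (gradGram A v).trace / √d := by field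
    _ ≤ frobNorm (shapeMatrix ξ v A) := (div_le_iff₀' (by positivity)).2 htrace

lemma inv_sqrt_le_minAltitude (hd : d ≠ 0) (hA : A.PosDef) (hv : AffineIndependent ℝ v) {Y : ℝ}
    (hY : 0 < Y) (h : ∀ j, gradGram A v j j ≤ Y) : (√Y)⁻¹ ≤ minAltitude A v := by
  have : Nontrivial (Fin (d + 1)) := Fin.nontrivial_iff_two_le.2 (by omega)
  refine le_ciInf fun j => ?_
  obtain ⟨l, hl⟩ := exists_ne j
  refine le_csInf ⟨_, v l, mem_affineSpan ℝ ⟨l, hl, rfl⟩, rfl⟩ ?_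
  rintro _ ⟨z, hz, rfl⟩
  have hquad := inv_le_dotProduct_mulVec hA (baryGrad_dotProduct_sub_eq_one hv hz) hY (h j)
  rw [dotProduct_mulVec_eq_sum] at hquad
  rw [← Real.sqrt_inv]
  exact Real.sqrt_le_sqrt hquad

lemma one_le_det_sq_mul (hd : d ≠ 0) (hA : A.PosDef) (hv : AffineIndependent ℝ v) {Y : ℝ}
    (h : ∀ j, gradGram A v j j ≤ Y) : 1 ≤ (edgeMatrix v).det ^ 2 * A.det * Y ^ d := by
  have : Nonempty (Fin d) := Fin.pos_iff_nonempty.1 (Nat.pos_of_ne_zero hd)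
  have hA' := hA.det_pos.ne'
  have hv' := affineIndependent_iff_det_homMatrix_ne_zero.1 hv
  rw [det_homMatrix] at hv'
  have hamgm : ((gradGram A v).submatrix Fin.succ Fin.succ).det ≤ Y ^ d := by
    refine (det_le_pow_of_trace_le (posSemidef_submatrix_gradGram hA hv) ?_).trans_eq
      (by rw [Fintype.card_fin])
    exact (Finset.sum_le_card_nsmul _ _ Y fun i _ => h i.succ).trans_eq (nsmul_eq_mul _ _)
  have hdet : (edgeMatrix v).det ^ 2 * A.det * ((gradGram A v).submatrix Fin.succ Fin.succ).det
      = 1 := by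
    rw [← inv_edgeMatrix_mul_inv_mul_transpose hv, Matrix.det_mul, Matrix.det_mul,
      Matrix.det_transpose, Matrix.det_nonsing_inv, Matrix.det_nonsing_inv, Ring.inverse_eq_inv']
    field
  rw [← hdet]
  exact mul_le_mul_of_nonneg_left hamgm (mul_nonneg (sq_nonneg _) hA.det_pos.le)

end Nondegenerate

/-! ### Coercivity of the meshing functional -/

lemma two_rpow_mul_rpow_le {a b c q : ℝ} (ha : 0 ≤ a) (hb : 0 ≤ b) (hc : 0 ≤ c) (hq : 1 ≤ q)
    (h : a ≤ b + c) : 2 ^ (1 - q) * a ^ q ≤ b ^ q + c ^ q := by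
  lift b to NNReal using hb
  lift c to NNReal using hc
  have hbc : ((b : ℝ) + c) ^ q ≤ 2 ^ (q - 1) * ((b : ℝ) ^ q + (c : ℝ) ^ q) := by
    exact_mod_cast NNReal.rpow_add_le_mul_rpow_add_rpow b c hq
  rw [← neg_sub q 1, Real.rpow_neg zero_le_two, inv_mul_le_iff₀ (by positivity)]
  exact (Real.rpow_le_rpow ha h (by linarith)).trans hbc

lemma simplexVolume_nonneg (v : Fin (d + 1) → Pt d) : 0 ≤ simplexVolume v :=
  measureReal_nonneg

lemma energy_nonneg (M : Pt d → Matrix (Fin d) (Fin d) ℝ) (ξ : Fin (d + 1) → Pt d) (p : ℝ)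
    (conn : Connectivity d N Nv) (σ : ℝ) (x : Config d Nv) : 0 ≤ energy M ξ p conn σ x :=
  Finset.sum_nonneg fun _ _ => mul_nonneg
    (mul_nonneg (simplexVolume_nonneg _) (Real.sqrt_nonneg _))
    (Real.rpow_nonneg (frobNorm_nonneg _) _)

lemma sqrt_pow_eq_rpow {m : ℝ} (hm : 0 ≤ m) (n : ℕ) : √(m ^ n) = m ^ ((n : ℝ) / 2) := by
  rw [Real.sqrt_eq_rpow, ← Real.rpow_natCast, ← Real.rpow_mul hm, mul_one_div]

section SpectralBounds

variable {mlo mhi : ℝ} {A : Matrix (Fin d) (Fin d) ℝ}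

lemma IsSpectrallyBounded.rpow_le_sqrt_det (hA : IsSpectrallyBounded mlo mhi A)
    (hmlo : 0 ≤ mlo) : mlo ^ ((d : ℝ) / 2) ≤ √A.det := by
  rw [← sqrt_pow_eq_rpow hmlo]
  simpa only [Fintype.card_fin] using Real.sqrt_le_sqrt (hA.pow_le_det hmlo)

lemma IsSpectrallyBounded.le [NeZero d] (hA : IsSpectrallyBounded mlo mhi A) : mlo ≤ mhi := by
  have h := (hA.lower (Pi.single 0 1)).trans (hA.upper (Pi.single 0 1))
  simpa using h

lemma IsSpectrallyBounded.sqrt_det_le_rpow (hA : IsSpectrallyBounded mlo mhi A)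
    (hmlo : 0 ≤ mlo) (hmhi : 0 ≤ mhi) : √A.det ≤ mhi ^ ((d : ℝ) / 2) := by
  rw [← sqrt_pow_eq_rpow hmhi]
  simpa only [Fintype.card_fin] using Real.sqrt_le_sqrt (hA.det_le_pow hmlo)

lemma IsSpectrallyBounded.volume_mul_frobNorm_rpow_le (hA : IsSpectrallyBounded mlo mhi A)
    (hmlo : 0 ≤ mlo) {p : ℝ} (hp : 1 ≤ 2 * p) (S : Matrix (Fin d) (Fin d) ℝ) (γ : ℝ) {w : ℝ}
    (hw : 0 ≤ w) :
    mlo ^ ((d : ℝ) / 2) * 2 ^ (1 - 2 * p) * (w * frobNorm S ^ (2 * p)) ≤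
      mlo ^ ((d : ℝ) / 2) * (γ ^ 2 * d) ^ p * w +
        w * √A.det * frobNorm (S - γ • (1 : Matrix (Fin d) (Fin d) ℝ)) ^ (2 * p) := by
  have hγ : frobNorm (γ • (1 : Matrix (Fin d) (Fin d) ℝ)) ^ (2 * p) = (γ ^ 2 * d) ^ p := by
    rw [frobNorm_smul_one, Real.sqrt_eq_rpow, ← Real.rpow_mul (by positivity)]
    ring_nf
  have hS := two_rpow_mul_rpow_le (frobNorm_nonneg S) (frobNorm_nonneg _) (frobNorm_nonneg _) hp
    (frobNorm_le_frobNorm_sub_add S (γ • 1))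
  rw [hγ] at hS
  have hF := Real.rpow_nonneg (frobNorm_nonneg (S - γ • 1)) (2 * p)
  calc mlo ^ ((d : ℝ) / 2) * 2 ^ (1 - 2 * p) * (w * frobNorm S ^ (2 * p))
      = mlo ^ ((d : ℝ) / 2) * w * (2 ^ (1 - 2 * p) * frobNorm S ^ (2 * p)) := by ring
    _ ≤ mlo ^ ((d : ℝ) / 2) * w * (frobNorm (S - γ • 1) ^ (2 * p) + (γ ^ 2 * d) ^ p) := by gcongr
    _ = mlo ^ ((d : ℝ) / 2) * (γ ^ 2 * d) ^ p * w +
        w * mlo ^ ((d : ℝ) / 2) * frobNorm (S - γ • 1) ^ (2 * p) := by ring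
    _ ≤ _ := by
      gcongr
      exact hA.rpow_le_sqrt_det hmlo

end SpectralBounds

lemma volume_mul_frobNorm_shapeMatrix_le_energy {mlo mhi : ℝ} (hmlo : 0 ≤ mlo)
    {M : Pt d → Matrix (Fin d) (Fin d) ℝ} (ξ : Fin (d + 1) → Pt d) {p : ℝ} (hp : 1 ≤ 2 * p)
    {conn : Connectivity d N Nv} {x : Config d Nv}
    (hM : ∀ k, IsSpectrallyBounded mlo mhi (avgMetric M (elem conn x k))) (σ : ℝ) (k : Fin N) :
    mlo ^ ((d : ℝ) / 2) * 2 ^ (1 - 2 * p) * (simplexVolume (elem conn x k) *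
        frobNorm (shapeMatrix ξ (elem conn x k) (avgMetric M (elem conn x k))) ^ (2 * p)) ≤
      beta d N p mlo σ * ∑ l, simplexVolume (elem conn x l) + energy M ξ p conn σ x := by
  set g : Fin N → ℝ := fun l => mlo ^ ((d : ℝ) / 2) * 2 ^ (1 - 2 * p) *
    (simplexVolume (elem conn x l) *
      frobNorm (shapeMatrix ξ (elem conn x l) (avgMetric M (elem conn x l))) ^ (2 * p))
  have hg : ∀ l, 0 ≤ g l := fun l => mul_nonneg (by positivity)
    (mul_nonneg (simplexVolume_nonneg _) (Real.rpow_nonneg (frobNorm_nonneg _) _))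
  refine (Finset.single_le_sum (fun l _ => hg l) (Finset.mem_univ k)).trans ?_
  rw [energy, Finset.mul_sum, ← Finset.sum_add_distrib]
  exact Finset.sum_le_sum fun l _ =>
    (hM l).volume_mul_frobNorm_rpow_le hmlo hp _ _ (simplexVolume_nonneg _)

/-! ### The lower bound for altitudes and volumes -/

/-- The constant by which the Frobenius norm of `shapeMatrix` controls the squared gradients of the
barycentric coordinates. -/
def shapeConstant (d : ℕ) : ℝ :=
  ((d : ℝ) + 1) / d * referenceScale d / √d

lemma shapeConstant_pos (hd : d ≠ 0) : 0 < shapeConstant d := by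
  have := referenceScale_pos d
  have : (0 : ℝ) < d := by positivity
  unfold shapeConstant
  positivity

/-- The lower bound for the altitudes of an element for which `mlo^{d/2} 2^{1-2p}` times its
contribution `|K| ‖S‖_F^{2p}` to the functional, `S` being its `shapeMatrix`, is at most `Q`. -/
def altitudeBound (d : ℕ) (p mlo mhi Q : ℝ) : ℝ :=
  (mlo ^ ((d : ℝ) / 2) * 2 ^ (1 - 2 * p) * shapeConstant d ^ (2 * p) /
    (d.factorial * mhi ^ ((d : ℝ) / 2) * Q)) ^ (1 / (4 * p - d))

lemma altitudeBound_pos (hd : d ≠ 0) {p mlo mhi Q : ℝ} (hmlo : 0 < mlo) (hmhi : 0 < mhi)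
    (hQ : 0 < Q) : 0 < altitudeBound d p mlo mhi Q := by
  have := shapeConstant_pos hd
  unfold altitudeBound
  positivity

section Element

variable {ξ v : Fin (d + 1) → Pt d} {A : Matrix (Fin d) (Fin d) ℝ}

/-- The radius is the reciprocal of the largest metric length of the gradients of the barycentric
coordinates. -/
lemma exists_radius (hd : d ≠ 0) (hξ : IsReferenceElement ξ) (hA : A.PosDef)
    (hv : AffineIndependent ℝ v) :
    ∃ ρ, 0 < ρ ∧ ρ ≤ minAltitude A v ∧ ρ ^ d ≤ d.factorial * √A.det * simplexVolume v ∧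
      shapeConstant d ≤ ρ ^ 2 * frobNorm (shapeMatrix ξ v A) := by
  obtain ⟨j, hj⟩ := Finite.exists_max fun l => gradGram A v l l
  set Y := gradGram A v j j
  have hvol : 1 ≤ (edgeMatrix v).det ^ 2 * A.det * Y ^ d := one_le_det_sq_mul hd hA hv hj
  have hY : 0 < Y := by
    refine (gradGram_self_nonneg hA v j).lt_of_ne fun (h : 0 = Y) => ?_
    rw [← h, zero_pow hd, mul_zero] at hvol
    exact absurd hvol (by norm_num)
  have hsq : (√Y)⁻¹ ^ 2 = Y⁻¹ := by rw [inv_pow, Real.sq_sqrt hY.le]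
  refine ⟨(√Y)⁻¹, by positivity, inv_sqrt_le_minAltitude hd hA hv hY hj, ?_, ?_⟩
  · have hvolume : d.factorial * √A.det * simplexVolume v = |(edgeMatrix v).det| * √A.det := by
      rw [simplexVolume_eq, det_homMatrix]
      field
    have hdet := hA.det_pos
    rw [hvolume]
    refine le_of_sq_le_sq ?_ (by positivity)
    rw [← pow_mul, mul_comm d, pow_mul, hsq, mul_pow, sq_abs, Real.sq_sqrt hdet.le, inv_pow]
    exact (inv_le_iff_one_le_mul₀ (by positivity)).2 hvol
  · rw [hsq, le_inv_mul_iff₀ hY, mul_comm]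
    exact mul_gradGram_self_le_frobNorm_shapeMatrix hd hξ hA hv j

lemma altitudeBound_le {p mlo mhi Q ρ F w : ℝ} (hpd : (d : ℝ) < 4 * p) (hmlo : 0 < mlo)
    (hmhi : 0 < mhi) (hρ : 0 < ρ) (hF : 0 ≤ F) (hQ : 0 < Q)
    (hshape : 0 ≤ shapeConstant d) (hρF : shapeConstant d ≤ ρ ^ 2 * F)
    (hρw : ρ ^ d ≤ d.factorial * mhi ^ ((d : ℝ) / 2) * w)
    (hwQ : mlo ^ ((d : ℝ) / 2) * 2 ^ (1 - 2 * p) * (w * F ^ (2 * p)) ≤ Q) :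
    altitudeBound d p mlo mhi Q ≤ ρ := by
  have he : 0 < 4 * p - d := sub_pos.2 hpd
  have hp : 0 < p := by have := d.cast_nonneg (α := ℝ); linarith
  have hpow : (ρ ^ 2 * F) ^ (2 * p) = ρ ^ (4 * p - d) * ρ ^ d * F ^ (2 * p) := by
    rw [Real.mul_rpow (by positivity) hF, ← Real.rpow_natCast_mul hρ.le, ← Real.rpow_natCast ρ d,
      ← Real.rpow_add hρ]
    ring_nf
  suffices mlo ^ ((d : ℝ) / 2) * 2 ^ (1 - 2 * p) * shapeConstant d ^ (2 * p) ≤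
      ρ ^ (4 * p - d) * (d.factorial * mhi ^ ((d : ℝ) / 2) * Q) by
    rw [altitudeBound, one_div, Real.rpow_inv_le_iff_of_pos (by positivity) hρ.le he]
    exact (div_le_iff₀ (by positivity)).2 this
  calc mlo ^ ((d : ℝ) / 2) * 2 ^ (1 - 2 * p) * shapeConstant d ^ (2 * p)
      ≤ mlo ^ ((d : ℝ) / 2) * 2 ^ (1 - 2 * p) * (ρ ^ 2 * F) ^ (2 * p) := by gcongr
    _ = mlo ^ ((d : ℝ) / 2) * 2 ^ (1 - 2 * p) * ρ ^ (4 * p - d) * F ^ (2 * p) * ρ ^ d := by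
      rw [hpow]
      ring
    _ ≤ mlo ^ ((d : ℝ) / 2) * 2 ^ (1 - 2 * p) * ρ ^ (4 * p - d) * F ^ (2 * p) *
        (d.factorial * mhi ^ ((d : ℝ) / 2) * w) := by gcongr
    _ = ρ ^ (4 * p - d) * (d.factorial * mhi ^ ((d : ℝ) / 2) *
        (mlo ^ ((d : ℝ) / 2) * 2 ^ (1 - 2 * p) * (w * F ^ (2 * p)))) := by ring
    _ ≤ ρ ^ (4 * p - d) * (d.factorial * mhi ^ ((d : ℝ) / 2) * Q) := by gcongr

theorem altitudeBound_le_minAltitude_and_le_simplexVolume (hd : d ≠ 0) {p mlo mhi Q : ℝ}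
    (hpd : (d : ℝ) < 4 * p) (hmlo : 0 < mlo) (hmhi : 0 < mhi) (hξ : IsReferenceElement ξ)
    (hA : IsSpectrallyBounded mlo mhi A) (hv : AffineIndependent ℝ v) (hQ : 0 < Q)
    (h : mlo ^ ((d : ℝ) / 2) * 2 ^ (1 - 2 * p) *
      (simplexVolume v * frobNorm (shapeMatrix ξ v A) ^ (2 * p)) ≤ Q) :
    altitudeBound d p mlo mhi Q ≤ minAltitude A v ∧
      altitudeBound d p mlo mhi Q ^ d / (d.factorial * mhi ^ ((d : ℝ) / 2)) ≤
        simplexVolume v := by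
  obtain ⟨ρ, hρ, haltitude, hvolume, hshape⟩ := exists_radius hd hξ (hA.posDef hmlo) hv
  have hvolume' : ρ ^ d ≤ d.factorial * mhi ^ ((d : ℝ) / 2) * simplexVolume v := by
    have := simplexVolume_nonneg v
    refine hvolume.trans ?_
    gcongr
    exact hA.sqrt_det_le_rpow hmlo.le hmhi.le
  have hbound : altitudeBound d p mlo mhi Q ≤ ρ :=
    altitudeBound_le hpd hmlo hmhi hρ (frobNorm_nonneg _) hQ (shapeConstant_pos hd).le hshape
      hvolume' h
  refine ⟨hbound.trans haltitude, (div_le_iff₀' (by positivity)).2 (le_trans ?_ hvolume')⟩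
  have := (altitudeBound_pos (p := p) hd hmlo hmhi hQ).le
  gcongr

end Element

/-! ### Comparison of the constants -/

lemma factorial_le_half_succ_pow (n : ℕ) : (n.factorial : ℝ) ≤ (((n : ℝ) + 1) / 2) ^ n := by
  induction n with
  | zero => simp
  | succ n ih =>
    have bernoulli : (2 : ℝ) ≤ (1 + 1 / ((n : ℝ) + 1)) ^ (n + 1) := by
      refine le_trans (le_of_eq ?_) (one_add_mul_le_pow (a := 1 / ((n : ℝ) + 1)) ?_ (n + 1))
      · push_cast
        field
      · exact le_trans (by norm_num) (by positivity : (0 : ℝ) ≤ 1 / ((n : ℝ) + 1))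
    calc ((n + 1).factorial : ℝ) = ((n : ℝ) + 1) * n.factorial := by
          rw [Nat.factorial_succ]
          push_cast
          rfl
      _ ≤ ((n : ℝ) + 1) * (((n : ℝ) + 1) / 2) ^ n := by gcongr
      _ = 2 * (((n : ℝ) + 1) / 2) ^ (n + 1) := by ring
      _ ≤ (1 + 1 / ((n : ℝ) + 1)) ^ (n + 1) * (((n : ℝ) + 1) / 2) ^ (n + 1) := by gcongr
      _ = (((n + 1 : ℕ) + 1 : ℝ) / 2) ^ (n + 1) := by
          rw [← mul_pow]
          congr 1
          push_cast
          field

lemma two_rpow_mul_factorial_le_rpow (hd : d ≠ 0) {q : ℝ} (hq : (d : ℝ) ≤ q) :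
    2 ^ q * (d.factorial : ℝ) ≤ ((d : ℝ) + 1) ^ q := by
  have hone : (1 : ℝ) ≤ ((d : ℝ) + 1) / 2 := by
    have : (1 : ℝ) ≤ d := by exact_mod_cast Nat.one_le_iff_ne_zero.2 hd
    linarith
  calc 2 ^ q * (d.factorial : ℝ) ≤ 2 ^ q * (((d : ℝ) + 1) / 2) ^ q := by
        gcongr
        refine (factorial_le_half_succ_pow d).trans ?_
        rw [← Real.rpow_natCast]
        exact Real.rpow_le_rpow_of_exponent_le hone hq
    _ = ((d : ℝ) + 1) ^ q := by
        rw [← Real.mul_rpow zero_le_two (by positivity), mul_div_cancel₀ _ two_ne_zero]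

lemma four_rpow_le (hd : d ≠ 0) (hN : N ≠ 0) (hdN : 2 ≤ d ∨ 2 ≤ N) {p : ℝ} (hp : 0 ≤ p) :
    (4 : ℝ) ^ p ≤
      (d : ℝ) ^ (3 * p) * ((d : ℝ) + 1) ^ (2 * p - 4 * p / d) * (N : ℝ) ^ (4 * p / d) := by
  have hN1 : (1 : ℝ) ≤ N := by exact_mod_cast Nat.one_le_iff_ne_zero.2 hN
  have h4 : (4 : ℝ) ^ p = 2 ^ (2 * p) := by
    rw [Real.rpow_mul zero_le_two]
    norm_num
  rcases (Nat.one_le_iff_ne_zero.2 hd).eq_or_lt with rfl | hd2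
  · have hN2 : (2 : ℝ) ≤ N := by exact_mod_cast hdN.resolve_left (by norm_num)
    calc (4 : ℝ) ^ p = 2 ^ (2 * p - 4 * p) * 2 ^ (4 * p) := by
          rw [h4, ← Real.rpow_add two_pos]
          ring_nf
      _ ≤ 2 ^ (2 * p - 4 * p) * (N : ℝ) ^ (4 * p) := by gcongr
      _ = _ := by norm_num
  · have hd2' : (2 : ℝ) ≤ d := by exact_mod_cast hd2
    have hexp : 0 ≤ 2 * p - 4 * p / d := by
      rw [sub_nonneg, div_le_iff₀ (by positivity)]
      nlinarith
    calc (4 : ℝ) ^ p ≤ 2 ^ (3 * p) := by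
          rw [h4]
          exact Real.rpow_le_rpow_of_exponent_le one_le_two (by linarith)
      _ = 2 ^ (3 * p) * 1 * 1 := by rw [mul_one, mul_one]
      _ ≤ _ := by
          gcongr
          · exact Real.one_le_rpow (by linarith) hexp
          · exact Real.one_le_rpow hN1 (by positivity)

lemma two_rpow_mul_factorial_le (hd : d ≠ 0) (hN : N ≠ 0) (hdN : 2 ≤ d ∨ 2 ≤ N) {p : ℝ}
    (hpd : (d : ℝ) ≤ 4 * p) :
    2 ^ (6 * p) * (d.factorial : ℝ) ≤
      (d : ℝ) ^ (3 * p) * ((d : ℝ) + 1) ^ (6 * p - 4 * p / d) * (N : ℝ) ^ (4 * p / d) := by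
  have hp : 0 ≤ p := by have := d.cast_nonneg (α := ℝ); linarith
  have h2 : (2 : ℝ) ^ (6 * p) = 4 ^ p * 2 ^ (4 * p) := by
    rw [show (4 : ℝ) = 2 ^ (2 : ℝ) by norm_num, ← Real.rpow_mul zero_le_two,
      ← Real.rpow_add two_pos]
    ring_nf
  have hd1 : ((d : ℝ) + 1) ^ (6 * p - 4 * p / d) =
      ((d : ℝ) + 1) ^ (2 * p - 4 * p / d) * ((d : ℝ) + 1) ^ (4 * p) := by
    rw [← Real.rpow_add (by positivity)]
    ring_nf
  rw [h2, hd1, mul_assoc]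
  refine (mul_le_mul (four_rpow_le hd hN hdN hp) (two_rpow_mul_factorial_le_rpow hd hpd)
    (by positivity) (by positivity)).trans (le_of_eq (by ring))

lemma referenceScale_rpow (hd : d ≠ 0) (p : ℝ) : referenceScale d ^ (2 * p) =
    (d.factorial : ℝ) ^ (4 * p / d) / ((d : ℝ) + 1) ^ (2 * p / d) := by
  have hd0 : (d : ℝ) ≠ 0 := Nat.cast_ne_zero.2 hd
  rw [referenceScale, ← Real.rpow_mul (by positivity),
    Real.div_rpow (by positivity) (by positivity), ← Real.rpow_natCast_mul (by positivity)]
  congr 2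
  · push_cast
    field
  · field

lemma shapeConstant_rpow (hd : d ≠ 0) (p : ℝ) : shapeConstant d ^ (2 * p) =
    (d.factorial : ℝ) ^ (4 * p / d) * ((d : ℝ) + 1) ^ (2 * p - 2 * p / d) / (d : ℝ) ^ (3 * p) := by
  have hd0 : (0 : ℝ) < d := by positivity
  have hscale := referenceScale_pos d
  have hd3 : (d : ℝ) ^ (3 * p) = (d : ℝ) ^ (2 * p) * (d : ℝ) ^ p := by
    rw [← Real.rpow_add hd0]
    ring_nf
  have hsqrt : √(d : ℝ) ^ (2 * p) = (d : ℝ) ^ p := by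
    rw [Real.sqrt_eq_rpow, ← Real.rpow_mul hd0.le]
    ring_nf
  rw [shapeConstant, Real.div_rpow (by positivity) (by positivity),
    Real.mul_rpow (by positivity) hscale.le, Real.div_rpow (by positivity) hd0.le, hsqrt,
    referenceScale_rpow hd, hd3, Real.rpow_sub (by positivity)]
  field

lemma C1_base_mul_le (hd : d ≠ 0) (hN : N ≠ 0) (hdN : 2 ≤ d ∨ 2 ≤ N) {p : ℝ}
    (hpd : (d : ℝ) ≤ 4 * p) {mlo mhi Q : ℝ} (hmlo : 0 ≤ mlo) (hmhi : 1 ≤ mhi) (hQ : 0 < Q) :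
    2 ^ (6 * p) * (d.factorial : ℝ) ^ (4 * p / d) * alpha d p mlo mhi /
        ((d : ℝ) ^ (4 * p) * ((d : ℝ) + 1) ^ (4 * p - 2 * p / d) * Q) *
        mhi ^ (-((d : ℝ) / 2)) * (N : ℝ) ^ (-(4 * p / d)) ≤
      mlo ^ ((d : ℝ) / 2) * 2 ^ (1 - 2 * p) * shapeConstant d ^ (2 * p) /
        (d.factorial * mhi ^ ((d : ℝ) / 2) * Q) := by
  have hd0 : (0 : ℝ) < d := by positivity
  have hN0 : (0 : ℝ) < N := by positivity
  have hm0 : 0 < mhi := by linarith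
  have hm : 1 ≤ mhi ^ (2 * p) := Real.one_le_rpow hmhi (by linarith)
  have hd6 : (d : ℝ) ^ (6 * p) = (d : ℝ) ^ (4 * p) * (d : ℝ) ^ (2 * p) := by
    rw [← Real.rpow_add hd0]
    ring_nf
  have hd3 : (d : ℝ) ^ (6 * p) = (d : ℝ) ^ (3 * p) * (d : ℝ) ^ (3 * p) := by
    rw [← Real.rpow_add hd0]
    ring_nf
  have hd1 : ((d : ℝ) + 1) ^ (6 * p - 4 * p / d) =
      ((d : ℝ) + 1) ^ (2 * p - 2 * p / d) * ((d : ℝ) + 1) ^ (4 * p - 2 * p / d) := by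
    rw [← Real.rpow_add (by positivity)]
    ring_nf
  set c := mlo ^ ((d : ℝ) / 2) * 2 ^ (1 - 2 * p) * (d.factorial : ℝ) ^ (4 * p / d) /
    (d.factorial * mhi ^ ((d : ℝ) / 2) * Q) with hc
  calc _ = c * (2 ^ (6 * p) * d.factorial) / (mhi ^ (2 * p) * ((d : ℝ) ^ (6 * p) *
        ((d : ℝ) + 1) ^ (4 * p - 2 * p / d) * (N : ℝ) ^ (4 * p / d))) := by
        rw [alpha, hc, hd6, Real.rpow_neg hm0.le, Real.rpow_neg hN0.le]
        field
    _ ≤ c * ((d : ℝ) ^ (3 * p) * ((d : ℝ) + 1) ^ (6 * p - 4 * p / d) * (N : ℝ) ^ (4 * p / d)) /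
        (1 * ((d : ℝ) ^ (6 * p) *
          ((d : ℝ) + 1) ^ (4 * p - 2 * p / d) * (N : ℝ) ^ (4 * p / d))) := by
        gcongr c * ?_ / (?_ * _)
        exact two_rpow_mul_factorial_le hd hN hdN hpd
    _ = _ := by
        rw [hd3, hd1, hc, shapeConstant_rpow hd]
        field

lemma C1_mul_le_altitudeBound (hd : d ≠ 0) (hN : N ≠ 0) (hdN : 2 ≤ d ∨ 2 ≤ N) {p : ℝ}
    (hpd : (d : ℝ) < 4 * p) {mlo mhi : ℝ} (hmlo : 0 ≤ mlo) (hmhi : 1 ≤ mhi)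
    {β w I₀ : ℝ} (hQ : 0 < β * w + I₀) :
    C1 d p (alpha d p mlo mhi) β w I₀ * mhi ^ (-((d : ℝ) / (2 * (4 * p - d)))) *
      (N : ℝ) ^ (-(4 * p / (d * (4 * p - d)))) ≤ altitudeBound d p mlo mhi (β * w + I₀) := by
  have : (0 : ℝ) < d := by positivity
  have hN0 : (0 : ℝ) < N := by positivity
  have hm0 : 0 < mhi := by linarith
  have he : 0 < 4 * p - d := sub_pos.2 hpd
  have hα : 0 ≤ alpha d p mlo mhi := by unfold alpha; positivity
  set Q := β * w + I₀ with hQdef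
  have hmhi_exp : mhi ^ (-((d : ℝ) / (2 * (4 * p - d)))) =
      (mhi ^ (-((d : ℝ) / 2))) ^ (1 / (4 * p - d)) := by
    rw [← Real.rpow_mul hm0.le]
    congr 1
    field
  have hN_exp : (N : ℝ) ^ (-(4 * p / (d * (4 * p - d)))) =
      ((N : ℝ) ^ (-(4 * p / d))) ^ (1 / (4 * p - d)) := by
    rw [← Real.rpow_mul hN0.le]
    congr 1
    field
  rw [C1, ← hQdef, altitudeBound, hmhi_exp, hN_exp, ← Real.mul_rpow (by positivity) (by positivity),
    ← Real.mul_rpow (by positivity) (by positivity)]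
  refine Real.rpow_le_rpow (by positivity) ?_ (by positivity)
  exact C1_base_mul_le hd hN hdN hpd.le hmlo hmhi hQ

lemma C2_mul_eq (hd : d ≠ 0) {mhi : ℝ} (hmhi : 0 < mhi) (p α β w I₀ : ℝ) :
    C2 d p α β w I₀ * mhi ^ (-((d : ℝ) ^ 2 / (2 * (4 * p - d))) - (d : ℝ) / 2) *
      (N : ℝ) ^ (-(4 * p / (4 * p - d))) =
    (C1 d p α β w I₀ * mhi ^ (-((d : ℝ) / (2 * (4 * p - d)))) *
      (N : ℝ) ^ (-(4 * p / (d * (4 * p - d))))) ^ d / (d.factorial * mhi ^ ((d : ℝ) / 2)) := by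
  have hd0 : (d : ℝ) ≠ 0 := Nat.cast_ne_zero.2 hd
  have hmhi_exp : -((d : ℝ) / (2 * (4 * p - d))) * d = -((d : ℝ) ^ 2 / (2 * (4 * p - d))) := by
    ring
  have hN_exp : -(4 * p / (d * (4 * p - d))) * d = -(4 * p / (4 * p - d)) := by
    rw [neg_mul, div_mul_eq_mul_div, mul_comm (4 * p), mul_div_mul_left _ _ hd0]
  rw [C2, mul_pow, mul_pow, ← Real.rpow_mul_natCast hmhi.le, ← Real.rpow_mul_natCast N.cast_nonneg,
    hmhi_exp, hN_exp, Real.rpow_sub hmhi]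
  field

lemma C2_mul_le_altitudeBound_pow (hd : d ≠ 0) (hN : N ≠ 0) (hdN : 2 ≤ d ∨ 2 ≤ N) {p : ℝ}
    (hpd : (d : ℝ) < 4 * p) {mlo mhi : ℝ} (hmlo : 0 ≤ mlo) (hmhi : 1 ≤ mhi)
    {β w I₀ : ℝ} (hQ : 0 < β * w + I₀) :
    C2 d p (alpha d p mlo mhi) β w I₀ *
        mhi ^ (-((d : ℝ) ^ 2 / (2 * (4 * p - d))) - (d : ℝ) / 2) *
        (N : ℝ) ^ (-(4 * p / (4 * p - d))) ≤
      altitudeBound d p mlo mhi (β * w + I₀) ^ d / (d.factorial * mhi ^ ((d : ℝ) / 2)) := by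
  have hm0 : 0 < mhi := by linarith
  have hα : 0 ≤ alpha d p mlo mhi := by unfold alpha; positivity
  have hC1 : 0 ≤ C1 d p (alpha d p mlo mhi) β w I₀ := by unfold C1; positivity
  rw [C2_mul_eq hd hm0]
  gcongr
  exact C1_mul_le_altitudeBound hd hN hdN hpd hmlo hmhi hQ

/-! ### The mesh never degenerates -/

lemma beta_pos (hd : d ≠ 0) (hN : N ≠ 0) (p : ℝ) {mlo σ : ℝ} (hmlo : 0 < mlo) (hσ : 0 < σ) :
    0 < beta d N p mlo σ := by
  have : (0 : ℝ) < N := by positivity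
  have : (0 : ℝ) < d := by positivity
  unfold beta
  positivity

lemma beta_anti (hN : N ≠ 0) {p mlo σ σ' : ℝ} (hp : 0 ≤ p) (hmlo : 0 ≤ mlo) (hσ : 0 < σ)
    (h : σ ≤ σ') : beta d N p mlo σ' ≤ beta d N p mlo σ := by
  have : (0 : ℝ) < N := by positivity
  have : 0 < σ' := hσ.trans_le h
  have hγ : (σ' / N) ^ (-(2 : ℝ) / d) ≤ (σ / N) ^ (-(2 : ℝ) / d) :=
    Real.rpow_le_rpow_of_nonpos (by positivity) (by gcongr)
      (div_nonpos_of_nonpos_of_nonneg (by norm_num) d.cast_nonneg)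
  unfold beta
  gcongr

lemma IsMetricTensor.upper_pos (hd : d ≠ 0) {Ω : Set (Pt d)} (hΩ : Ω.Nonempty) {mlo mhi : ℝ}
    (hmlo : 0 < mlo) {M : Pt d → Matrix (Fin d) (Fin d) ℝ} (hM : IsMetricTensor Ω mlo mhi M) :
    0 < mhi := by
  obtain ⟨y, hy⟩ := hΩ
  have : NeZero d := ⟨hd⟩
  exact hmlo.trans_le (isSpectrallyBounded_of_posSemidef (hM.lower y hy) (hM.upper y hy)).le

section Mesh

variable {Ω : Set (Pt d)} {conn : Connectivity d N Nv} {x : Config d Nv} {mlo mhi : ℝ}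
  {M : Pt d → Matrix (Fin d) (Fin d) ℝ}

namespace IsNonsingularMesh

lemma sum_simplexVolume (h : IsNonsingularMesh Ω conn x) (hfr : volume (frontier Ω) = 0) :
    ∑ k, simplexVolume (elem conn x k) = volume.real Ω := by
  calc ∑ k, simplexVolume (elem conn x k) = (meshMeasure conn x).real Set.univ := by
        simp only [measureReal_def, meshMeasure, Measure.finsetSum_apply,
          Measure.restrict_apply_univ]
        rw [ENNReal.toReal_sum fun k _ => (isCompact_simplex _).measure_lt_top.ne]
        rfl
    _ = volume.real Ω := by
        rw [h.meshMeasure_eq, measureReal_restrict_apply_univ, measureReal_def,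
          measure_closure_of_null_frontier hfr, measureReal_def]

lemma card_ne_zero (h : IsNonsingularMesh Ω conn x) (hΩ : Ω.Nonempty) : N ≠ 0 := by
  rintro rfl
  exact hΩ.closure.ne_empty (h.cover ▸ Set.iUnion_of_empty _)

lemma volume_real_pos (h : IsNonsingularMesh Ω conn x) (hfr : volume (frontier Ω) = 0)
    (hΩ : Ω.Nonempty) : 0 < volume.real Ω := by
  have : NeZero N := ⟨h.card_ne_zero hΩ⟩
  rw [← h.sum_simplexVolume hfr]
  exact Finset.sum_pos (fun k _ => simplexVolume_pos_iff.2 (h.nondegenerate k))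
    Finset.univ_nonempty

lemma isSpectrallyBounded_avgMetric (h : IsNonsingularMesh Ω conn x) (hΩ : IsOpen Ω)
    (hfr : volume (frontier Ω) = 0) (hmlo : 0 ≤ mlo) (hM : IsMetricTensor Ω mlo mhi M)
    (k : Fin N) : IsSpectrallyBounded mlo mhi (avgMetric M (elem conn x k)) :=
  hM.isSpectrallyBounded_avgMetric hmlo hΩ hfr (h.nondegenerate k)
    (h.cover ▸ Set.subset_iUnion (fun l => simplex (elem conn x l)) k)

lemma le_sigmaH (h : IsNonsingularMesh Ω conn x) (hΩ : IsOpen Ω) (hfr : volume (frontier Ω) = 0)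
    (hmlo : 0 ≤ mlo) (hM : IsMetricTensor Ω mlo mhi M) :
    mlo ^ ((d : ℝ) / 2) * volume.real Ω ≤ sigmaH M conn x := by
  rw [← h.sum_simplexVolume hfr, Finset.mul_sum, sigmaH]
  refine Finset.sum_le_sum fun k _ => ?_
  rw [mul_comm]
  exact mul_le_mul_of_nonneg_left
    ((h.isSpectrallyBounded_avgMetric hΩ hfr hmlo hM k).rpow_le_sqrt_det hmlo)
    (simplexVolume_nonneg _)

lemma altitudeBound_le (h : IsNonsingularMesh Ω conn x) (hd : d ≠ 0) (hΩ : IsOpen Ω)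
    (hfr : volume (frontier Ω) = 0) (hmlo : 0 < mlo) (hmhi : 0 < mhi)
    (hM : IsMetricTensor Ω mlo mhi M) {ξ : Fin (d + 1) → Pt d} (hξ : IsReferenceElement ξ)
    {p : ℝ} (hp : 1 ≤ 2 * p) (hpd : (d : ℝ) < 4 * p) {σ Q : ℝ} (hQ : 0 < Q)
    (hE : beta d N p mlo σ * volume.real Ω + energy M ξ p conn σ x ≤ Q) (k : Fin N) :
    altitudeBound d p mlo mhi Q ≤ minAltitude (avgMetric M (elem conn x k)) (elem conn x k) ∧
      altitudeBound d p mlo mhi Q ^ d / (d.factorial * mhi ^ ((d : ℝ) / 2)) ≤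
        simplexVolume (elem conn x k) := by
  have hbounded := h.isSpectrallyBounded_avgMetric hΩ hfr hmlo.le hM
  have hcoercive := volume_mul_frobNorm_shapeMatrix_le_energy hmlo.le ξ hp hbounded σ k
  rw [h.sum_simplexVolume hfr] at hcoercive
  exact altitudeBound_le_minAltitude_and_le_simplexVolume hd hpd hmlo hmhi hξ (hbounded k)
    (h.nondegenerate k) hQ (hcoercive.trans hE)

end IsNonsingularMesh

end Mesh

lemma pos_of_forall_le_of_pos {f : ℝ → ℝ} {t δ : ℝ} (hf : ContinuousOn f (Set.Icc 0 t))
    (h₀ : 0 < f 0) (hδ : 0 < δ)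
    (h : ∀ s ∈ Set.Icc 0 t, (∀ r ∈ Set.Icc 0 s, 0 < f r) → δ ≤ f s) :
    ∀ s ∈ Set.Icc 0 t, 0 < f s := by
  by_contra! hneg
  obtain ⟨s₀, hs₀, hfs₀⟩ := hneg
  have hδ₀ : δ ≤ f 0 := by
    refine h 0 ⟨le_rfl, hs₀.1.trans hs₀.2⟩ fun r hr => ?_
    rwa [le_antisymm hr.2 hr.1]
  -- At the first time with `f s ≤ δ / 2`, `f` is still positive.
  obtain ⟨s, ⟨hs, hfs⟩, hmin⟩ : ∃ s, IsLeast {s ∈ Set.Icc 0 t | f s ≤ δ / 2} s :=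
    (isCompact_Icc.of_isClosed_subset
      (hf.preimage_isClosed_of_isClosed isClosed_Icc isClosed_Iic) fun _ hr => hr.1).exists_isLeast
      ⟨s₀, hs₀, hfs₀.trans (by positivity)⟩
  obtain ⟨r, hr, hfr⟩ : δ / 2 ∈ f '' Set.Icc 0 s :=
    intermediate_value_Icc' hs.1 (hf.mono (Set.Icc_subset_Icc_right hs.2))
      ⟨hfs, (half_lt_self hδ).le.trans hδ₀⟩
  have hrs : r = s := le_antisymm hr.2 (hmin ⟨⟨hr.1, hr.2.trans hs.2⟩, hfr.le⟩)
  have hpos : ∀ q ∈ Set.Icc 0 s, 0 < f q := by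
    intro q hq
    by_contra! hfq
    have hqs : q = s := le_antisymm hq.2 (hmin ⟨⟨hq.1, hq.2.trans hs.2⟩, by linarith⟩)
    rw [hqs, ← hrs, hfr] at hfq
    linarith
  linarith [h s hs hpos]

lemma nondegenerate_iff_prod_pos {conn : Connectivity d N Nv} {x : Config d Nv} :
    Nondegenerate conn x ↔ 0 < ∏ k, simplexVolume (elem conn x k) := by
  refine ⟨fun h => Finset.prod_pos fun k _ => simplexVolume_pos_iff.2 (h k), fun h k => ?_⟩
  exact simplexVolume_pos_iff.1 ((simplexVolume_nonneg _).lt_of_ne'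
    (Finset.prod_ne_zero_iff.1 h.ne' k (Finset.mem_univ k)))

lemma nondegenerate_of_forall_le_simplexVolume {conn : Connectivity d N Nv}
    {x : ℝ → Config d Nv} {t δ : ℝ} (hx : ContinuousOn x (Set.Icc 0 t))
    (h₀ : Nondegenerate conn (x 0)) (hδ : 0 < δ)
    (h : ∀ s ∈ Set.Icc 0 t, (∀ r ∈ Set.Icc 0 s, Nondegenerate conn (x r)) →
      ∀ k, δ ≤ simplexVolume (elem conn (x s) k)) :
    ∀ s ∈ Set.Icc 0 t, Nondegenerate conn (x s) := by
  simp only [nondegenerate_iff_prod_pos] at h₀ h ⊢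
  refine pos_of_forall_le_of_pos (δ := ∏ _k : Fin N, δ) ?_ h₀ (Finset.prod_pos fun _ _ => hδ)
    fun s hs hpos => Finset.prod_le_prod (fun _ _ => hδ.le) fun k _ => h s hs hpos k
  refine continuousOn_finsetProd _ fun k _ => ?_
  simp only [simplexVolume_eq]
  exact ((continuous_det_homMatrix_elem conn k).comp_continuousOn hx).abs.div_const _

section Trajectory

variable {Ω : Set (Pt d)} {mlo mhi : ℝ} {M : Pt d → Matrix (Fin d) (Fin d) ℝ}
  {ξ : Fin (d + 1) → Pt d} {p : ℝ} {conn : Connectivity d N Nv} {σ : Config d Nv → ℝ}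
  {V : Fin Nv → Submodule ℝ (Pt d)} {P : Fin Nv → ℝ → ℝ} {τ : ℝ} {T : EReal} {x : ℝ → Config d Nv}

theorem IsTrajectory.nondegenerate
    (hx : IsTrajectory conn (fun y => energy M ξ p conn (σ y) y) V P τ T x) (hd : d ≠ 0)
    (hΩ : IsOpen Ω) (hΩne : Ω.Nonempty) (hfr : volume (frontier Ω) = 0) (hmlo : 0 < mlo)
    (hM : IsMetricTensor Ω mlo mhi M) (hξ : IsReferenceElement ξ) (hp : 1 ≤ 2 * p)
    (hpd : (d : ℝ) < 4 * p) {σ₀ : ℝ} (hσ₀ : 0 < σ₀)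
    (hσ : ∀ y, IsNonsingularMesh Ω conn y → σ₀ ≤ σ y) (hτ : 0 < τ) (hP : ∀ i t, 0 < P i t)
    (h₀ : IsNonsingularMesh Ω conn (x 0)) (hV : ∀ i, V i ≤ slideSpace conn (x 0) i) {t : ℝ}
    (htT : (t : EReal) < T) : ∀ r ∈ Set.Icc 0 t, Nondegenerate conn (x r) := by
  have hmhi := hM.upper_pos hd hΩne hmlo
  have hN := h₀.card_ne_zero hΩne
  have hβ := beta_pos hd hN p hmlo hσ₀
  have hw := h₀.volume_real_pos hfr hΩne
  have hI₀ := energy_nonneg M ξ p conn (σ (x 0)) (x 0)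
  have hlt : ∀ r ∈ Set.Icc 0 t, (r : EReal) < T := fun r hr =>
    (EReal.coe_le_coe_iff.2 hr.2).trans_lt htT
  set Q := beta d N p mlo σ₀ * volume.real Ω + energy M ξ p conn (σ (x 0)) (x 0)
  have hQ : 0 < Q := by positivity
  have hbound := altitudeBound_pos (p := p) hd hmlo hmhi hQ
  refine nondegenerate_of_forall_le_simplexVolume
    (δ := altitudeBound d p mlo mhi Q ^ d / (d.factorial * mhi ^ ((d : ℝ) / 2)))
    (hx.continuousOn.mono fun r hr => ⟨hr.1, hlt r hr⟩) h₀.nondegenerate (by positivity) ?_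
  intro s hs hnd k
  have hmesh := hx.isNonsingularMesh hd hΩ h₀ hV hs.1 (hlt s hs) hnd
  refine (hmesh.altitudeBound_le hd hΩ hfr hmlo hmhi hM hξ hp hpd hQ
    (add_le_add ?_ (hx.energy_le hτ hP hs.1 (hlt s hs) hnd)) k).2
  exact mul_le_mul_of_nonneg_right (beta_anti hN (by linarith) hmlo.le hσ₀ (hσ _ hmesh)) hw.le

end Trajectory

lemma IsNonsingularMesh.exists_le_sigma {Ω : Set (Pt d)} (hΩ : IsOpen Ω) (hΩne : Ω.Nonempty)
    (hfr : volume (frontier Ω) = 0) {mlo mhi : ℝ} (hmlo : 0 < mlo)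
    {M : Pt d → Matrix (Fin d) (Fin d) ℝ} (hM : IsMetricTensor Ω mlo mhi M)
    {conn : Connectivity d N Nv} {x : Config d Nv} (h : IsNonsingularMesh Ω conn x)
    {σ : Config d Nv → ℝ}
    (hσ : (∀ y, σ y = sigmaH M conn y) ∨ ∃ c : ℝ, 0 < c ∧ ∀ y, σ y = c) :
    ∃ σ₀ > 0, ∀ y, IsNonsingularMesh Ω conn y → σ₀ ≤ σ y := by
  rcases hσ with hσ | ⟨c, hc, hσ⟩
  · have := h.volume_real_pos hfr hΩne
    exact ⟨mlo ^ ((d : ℝ) / 2) * volume.real Ω, by positivity,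
      fun y hy => (hσ y).symm ▸ hy.le_sigmaH hΩ hfr hmlo.le hM⟩
  · exact ⟨c, hc, fun y _ => (hσ y).ge⟩

theorem corollary4p1_general
    (hd : d ≠ 0) {Ω : Set (Pt d)} (hΩ : IsOpen Ω) (hΩne : Ω.Nonempty)
    (hfr : volume (frontier Ω) = 0) {mlo mhi : ℝ} (hmlo : 0 < mlo)
    {M : Pt d → Matrix (Fin d) (Fin d) ℝ} (hM : IsMetricTensor Ω mlo mhi M)
    {ξ : Fin (d + 1) → Pt d} (hξ : IsReferenceElement ξ) {p : ℝ} (hp : 1 ≤ 2 * p)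
    (hpd : (d : ℝ) < 4 * p) {conn : Connectivity d N Nv} {σ : Config d Nv → ℝ} {σ₀ : ℝ}
    (hσ₀ : 0 < σ₀) (hσ : ∀ y, IsNonsingularMesh Ω conn y → σ₀ ≤ σ y)
    {τ : ℝ} (hτ : 0 < τ) {P : Fin Nv → ℝ → ℝ} (hP : ∀ i t, 0 < P i t) {T : EReal}
    {x : ℝ → Config d Nv} (h₀ : IsNonsingularMesh Ω conn (x 0))
    {V : Fin Nv → Submodule ℝ (Pt d)} (hV : ∀ i, V i ≤ slideSpace conn (x 0) i)
    (hx : IsTrajectory conn (fun y => energy M ξ p conn (σ y) y) V P τ T x)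
    {t : ℝ} (ht : 0 ≤ t) (htT : (t : EReal) < T) :
    IsNonsingularMesh Ω conn (x t) ∧
    mlo ^ ((d : ℝ) / 2) * volume.real Ω ≤ sigmaH M conn (x t) ∧
    (1 ≤ mhi → (2 ≤ d ∨ 2 ≤ N) → ∀ k : Fin N,
      C1 d p (alpha d p mlo mhi) (beta d N p mlo (σ (x t))) (volume.real Ω)
          (energy M ξ p conn (σ (x 0)) (x 0)) *
        mhi ^ (-((d : ℝ) / (2 * (4 * p - d)))) * (N : ℝ) ^ (-(4 * p / (d * (4 * p - d))))
          ≤ minAltitude (avgMetric M (elem conn (x t) k)) (elem conn (x t) k) ∧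
      C2 d p (alpha d p mlo mhi) (beta d N p mlo (σ (x t))) (volume.real Ω)
          (energy M ξ p conn (σ (x 0)) (x 0)) *
        mhi ^ (-((d : ℝ) ^ 2 / (2 * (4 * p - d))) - (d : ℝ) / 2) *
        (N : ℝ) ^ (-(4 * p / (4 * p - d)))
          ≤ simplexVolume (elem conn (x t) k)) := by
  have hnd := hx.nondegenerate hd hΩ hΩne hfr hmlo hM hξ hp hpd hσ₀ hσ hτ hP h₀ hV htT
  have hmesh := hx.isNonsingularMesh hd hΩ h₀ hV ht htT hnd
  refine ⟨hmesh, hmesh.le_sigmaH hΩ hfr hmlo.le hM, fun hmhi hdN k => ?_⟩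
  have hN := h₀.card_ne_zero hΩne
  have hβ := beta_pos hd hN p hmlo (hσ₀.trans_le (hσ _ hmesh))
  have hw := h₀.volume_real_pos hfr hΩne
  have hQ := add_pos_of_pos_of_nonneg (mul_pos hβ hw)
    (energy_nonneg M ξ p conn (σ (x 0)) (x 0))
  obtain ⟨haltitude, hvolume⟩ := hmesh.altitudeBound_le hd hΩ hfr hmlo (zero_lt_one.trans_le hmhi)
    hM hξ hp hpd hQ (add_le_add_right (hx.energy_le hτ hP ht htT hnd) _) k
  exact ⟨(C1_mul_le_altitudeBound hd hN hdN hpd hmlo.le hmhi hQ).trans haltitude,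
    (C2_mul_le_altitudeBound_pow hd hN hdN hpd hmlo.le hmhi hQ).trans hvolume⟩

end

end MovingMesh

open MovingMesh in
theorem corollary4p1
    {d N Nv : ℕ} (hd : 1 ≤ d)
    -- the domain, the metric tensor and the reference element
    (Ω : Set (Pt d)) (hΩ : IsPolyhedralDomain Ω)
    (mlo mhi : ℝ) (hmlo : 0 < mlo)
    (M : Pt d → Matrix (Fin d) (Fin d) ℝ) (hM : IsMetricTensor Ω mlo mhi M)
    (ξ : Fin (d + 1) → Pt d) (hξ : IsReferenceElement ξ)
    (p : ℝ) (hp : 1 ≤ p) (hpd : (d : ℝ) < 4 * p)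
    -- `σ_h` is the mesh quantity, or is frozen to a positive constant
    (conn : Connectivity d N Nv) (σ : Config d Nv → ℝ)
    (hσ : (∀ y, σ y = sigmaH M conn y) ∨ ∃ c : ℝ, 0 < c ∧ ∀ y, σ y = c)
    -- the mesh equation and its trajectory, from a nonsingular initial mesh
    (τ : ℝ) (hτ : 0 < τ) (P : Fin Nv → ℝ → ℝ) (hP : ∀ i t, 0 < P i t)
    (T : EReal) (x : ℝ → Config d Nv)
    (h₀ : IsNonsingularMesh Ω conn (x 0))
    (V : Fin Nv → Submodule ℝ (Pt d)) (hV : ∀ i, V i ≤ slideSpace conn (x 0) i)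
    (hx : IsTrajectory conn (fun y => energy M ξ p conn (σ y) y) V P τ T x) :
    ∀ t : ℝ, 0 ≤ t → (t : EReal) < T →
      IsNonsingularMesh Ω conn (x t) ∧
      mlo ^ ((d : ℝ) / 2) * MeasureTheory.volume.real Ω ≤ sigmaH M conn (x t) ∧
      (1 ≤ mhi → (2 ≤ d ∨ 2 ≤ N) → ∀ k : Fin N,
        C1 d p (alpha d p mlo mhi) (beta d N p mlo (σ (x t))) (MeasureTheory.volume.real Ω)
            (energy M ξ p conn (σ (x 0)) (x 0)) *
          mhi ^ (-((d : ℝ) / (2 * (4 * p - d)))) * (N : ℝ) ^ (-(4 * p / (d * (4 * p - d))))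
            ≤ minAltitude (avgMetric M (elem conn (x t) k)) (elem conn (x t) k) ∧
        C2 d p (alpha d p mlo mhi) (beta d N p mlo (σ (x t))) (MeasureTheory.volume.real Ω)
            (energy M ξ p conn (σ (x 0)) (x 0)) *
          mhi ^ (-((d : ℝ) ^ 2 / (2 * (4 * p - d))) - (d : ℝ) / 2) *
          (N : ℝ) ^ (-(4 * p / (4 * p - d)))
            ≤ simplexVolume (elem conn (x t) k)) := by
  obtain ⟨σ₀, hσ₀, hσ₀_le⟩ := h₀.exists_le_sigma hΩ.isOpen hΩ.isConnected.nonempty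
    hΩ.volume_frontier hmlo hM hσ
  exact fun t ht htT => corollary4p1_general (by omega) hΩ.isOpen hΩ.isConnected.nonempty
    hΩ.volume_frontier hmlo hM hξ (by linarith) hpd hσ₀ hσ₀_le hτ hP h₀ hV hx ht htT
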